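/- Let $\alpha:(0,\infty)\to(0,\infty)$ be a dimension function, that is, an increasing function with $\alpha(u)\to 0$ as $u\to 0$. Suppose that $$\lim_{x\to 0^+}\frac{\log\alpha(x)}{\log x}=\nu\in(0,\infty),$$ and that for some $\rho<1$ $$\frac{\alpha(x_1)}{\alpha(x_2)}\ge\left(\frac{x_1}{x_2}\right)^{\rho}\quad\text{for all sufficiently small } 0<x_1<x_2 .$$ Let $\omega:[0,\infty)\to(0,\infty)$ be an increasing function with $\lim_{\xi\to\infty}\omega(\xi)=\infty$. Then there exist a compact set $F_\alpha\subset\mathbb{R}$ of zero generalized Hausdorff measure $\mathcal{H}_\alpha(F_\alpha)=0$, a Borel probability measure $\mu$ supported on $F_\alpha$, and a constant $C$ such that $$|\hat\mu(\xi)|\le C\sqrt{\alpha(1/|\xi|)}\,\omega(|\xi|)\quad\text{for all real }\xi\ne 0,\qquad \hat\mu(\xi)=\int e^{-2\pi i x\xi}\,d\mu(x).$$ Moreover $F_\alpha$ can be chosen to be a subset of the set of well-approximable numbers $$E(\psi)=\Big\{x\in\mathbb{R}:\Big|x-\frac pq\Big|\le\psi(q)\text{ for infinitely many pairs of integers }(p,q),\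 q\ge 1\Big\},\qquad \psi(q)=\alpha^{-1}(q^{-2}),$$ where $\alpha^{-1}(t)=\inf\{x>0:\alpha(x)\ge t\}$ (the usual inverse function when $\alpha$ is strictly increasing and $t$ is one of its values), and $\psi(q):=0$ for the at most finitely many $q$ with $\{x>0:\alpha(x)\ge q^{-2}\}=\emptyset$. Here "increasing" means nondecreasing. -/

import Mathlib

open Filter Topology MeasureTheory
open scoped ENNReal

noncomputable section

/-- A dimension function: positive and increasing on `(0, ∞)`, with limit `0` at `0`.
Values of `α` outside `(0, ∞)` play no role. -/
structure IsDimensionFunction (α : ℝ → ℝ) : Prop where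
  pos : ∀ x, 0 < x → 0 < α x
  mono : MonotoneOn α (Set.Ioi 0)
  tendsto_zero : Tendsto α (𝓝[>] 0) (𝓝 0)

/-- The gauge `d ↦ α d` on diameters `d ∈ [0, ∞]`, with `α 0 = lim_{u → 0} α u = 0`, and
`∞` at infinite diameter (which has no influence on Hausdorff measures). -/
def dimGauge (α : ℝ → ℝ) (d : ℝ≥0∞) : ℝ≥0∞ :=
  if d = 0 then 0 else if d = ∞ then ∞ else ENNReal.ofReal (α d.toReal)

/-- The generalized Hausdorff measure `H_α` on `ℝ`:
`H_α(E) = sup_{r > 0} inf {∑ α(diam Uₙ) : E ⊆ ⋃ Uₙ, diam Uₙ ≤ r}`. -/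
def hausdorffMeasureOf (α : ℝ → ℝ) : Measure ℝ :=
  Measure.mkMetric (dimGauge α)

/-- The inverse `α⁻¹(t) = inf {x > 0 : α(x) ≥ t}` of an increasing function on `(0, ∞)`.
It is the usual inverse if `α` is strictly increasing and `t` is a value of `α`;
if `α` is continuous and has flat pieces it is the smallest solution of `α(x) = t`. -/
def increasingInverse (α : ℝ → ℝ) (t : ℝ) : ℝ :=
  sInf {x : ℝ | 0 < x ∧ t ≤ α x}

/-- The set `E(ψ)` of `ψ`-well-approximable numbers: the `x` with `|x - p/q| ≤ ψ(q)` for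
infinitely many pairs of integers `(p, q)`, `q ≥ 1`. -/
def psiApproximable (ψ : ℕ → ℝ) : Set ℝ :=
  {x : ℝ | {pq : ℤ × ℕ | 1 ≤ pq.2 ∧ |x - (pq.1 : ℝ) / (pq.2 : ℝ)| ≤ ψ pq.2}.Infinite}

/-- The Fourier transform `μ̂(ξ) = ∫ e^{-2πi x ξ} dμ(x)` of a finite measure on `ℝ`. -/
def measureFourier (μ : Measure ℝ) (ξ : ℝ) : ℂ :=
  ∫ x : ℝ, Complex.exp (-2 * (Real.pi : ℂ) * Complex.I * (x : ℂ) * (ξ : ℂ)) ∂μ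

end

/-!
The measure is a weak limit of probability measures with densities proportional to
`χ₀ g₀ g₁ ⋯ g_{j-1}`, where `χ₀` is a smooth bump on `[0, 1]` and `g_j` is a `1`-periodic
nonnegative kernel carried by the points within `ψ(p)` of a fraction `a / p`, with `p` in a finite
set `P_j` of large primes.

The kernel `g_j` is the average of the combs of bumps of width `ψ(p)` around the fractions `a / p`,
with weights proportional to `1 / p` (`primeKernel`). By Poisson summation its `k`-th Fourier
coefficient is `S⁻¹ ∑_{p ∈ P_j, p ∣ k} p⁻¹ φ̂(ψ(p) k)`, where `S = ∑_{p ∈ P_j} 1 / p`. Since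
`α(ψ(p))` is comparable to `p⁻²`, the weight `1 / p` matches the decay rate `√α(1/|k|)` at the
critical frequency `|k| = 1 / ψ(p)`; elsewhere the monotonicity of `α`, the growth condition and the
decay of `φ̂` give, for `B` with `ψ(p) ≥ p^{-B}`,
`p⁻¹ |φ̂(ψ(p) k)| ≲ √α(1/|k|) min(1, p^B / |k|)`. An integer `k` has at most `2B`
prime divisors `p` with `p^{2B} ≥ |k|`, and the smaller ones contribute at most `1` in total, so
the coefficients are `≤ (C / S) √α(1/|k|)` with no logarithmic loss (`sum_prime_divisors_min_le`,
`exists_norm_kernelCoeff_le`). Weights `1 / p` on primes of very different sizes are what makes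
this possible: with all primes in `[N, 2N]`, the same argument would lose a factor `log N`.

The only loss is the factor `1 / S`. As `∑ 1 / p` diverges, `P_j` can be chosen beyond any bound
with `S` between `ε_j` and `2 ε_j`. Covering by the balls around the fractions shows that the
`α`-Hausdorff measure is `O(ε_j)` for every `j` (`sum_dimGauge_le`), hence zero. On the Fourier
side, the decay rate is a moderate weight, so multiplying a density by `g_j` perturbs its transform
by `O(√α(1/|ξ|) / ε_j)`, and by an arbitrarily small amount on bounded sets of `ξ` if `P_j` starts
late enough. Because `ω → ∞`, this is `≤ ε_j √α(1/|ξ|) ω(|ξ|)` once `P_j` starts late enough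
(`exists_amplitude_step`), and these errors are summable. The limit exists by Prokhorov's theorem
(`exists_limit_measure`).

Of the hypotheses on `α`, the growth condition enters only through its weakening to the exponent
`1`, that is, `α(x) / x` is nonincreasing near `0`; the limit `ν > 0` enters only through a
polynomial lower bound for `ψ`.
-/

open scoped FourierTransform SchwartzMap

/-! ### The decay rate and the radii -/

/-- The growth condition implies that `α(x) / x` is nonincreasing near `0`. -/
theorem gauge_ratio_le {α : ℝ → ℝ} (hα : IsDimensionFunction α) {ρ : ℝ} (hρ : ρ < 1)
    (hgrowth : ∃ δ : ℝ, 0 < δ ∧ ∀ x₁ x₂ : ℝ, 0 < x₁ → x₁ < x₂ → x₂ < δ →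
      (x₁ / x₂) ^ ρ ≤ α x₁ / α x₂) :
    ∃ δ : ℝ, 0 < δ ∧ ∀ x₁ x₂ : ℝ, 0 < x₁ → x₁ ≤ x₂ → x₂ < δ → x₁ * α x₂ ≤ x₂ * α x₁ := by
  obtain ⟨δ, hδ, h⟩ := hgrowth
  refine ⟨δ, hδ, fun x₁ x₂ h1 h12 h2 => ?_⟩
  rcases h12.eq_or_lt with rfl | hlt
  · exact le_rfl
  have hx2 : 0 < x₂ := h1.trans hlt
  have h3 := h x₁ x₂ h1 hlt h2
  have h4 : x₁ / x₂ ≤ (x₁ / x₂) ^ ρ := by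
    have := Real.rpow_le_rpow_of_exponent_ge (div_pos h1 hx2)
      ((div_le_one hx2).2 h12) hρ.le
    simpa using this
  have h5 := h4.trans h3
  rw [div_le_div_iff₀ hx2 (hα.pos _ hx2)] at h5
  linarith

/-- The decay rate `√α(1/|t|)` that the Fourier transform is compared with. -/
noncomputable def decayRate (α : ℝ → ℝ) (t : ℝ) : ℝ := Real.sqrt (α (1 / |t|))

theorem decayRate_pos {α : ℝ → ℝ} (hα : IsDimensionFunction α) {t : ℝ} (ht : t ≠ 0) :
    0 < decayRate α t :=
  Real.sqrt_pos.2 (hα.pos _ (by positivity))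

theorem decayRate_nonneg (α : ℝ → ℝ) (t : ℝ) : 0 ≤ decayRate α t := Real.sqrt_nonneg _

theorem decayRate_anti {α : ℝ → ℝ} (hα : IsDimensionFunction α) {s t : ℝ} (hs : s ≠ 0)
    (hst : |s| ≤ |t|) : decayRate α t ≤ decayRate α s := by
  have hs' : 0 < |s| := abs_pos.2 hs
  have ht' : 0 < |t| := hs'.trans_le hst
  exact Real.sqrt_le_sqrt (hα.mono (by simpa using ht') (by simpa using hs')
    (one_div_le_one_div_of_le hs' hst))

/-- The decay rate is a moderate weight: it loses at most a factor `1 + |ξ - k|` when the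
frequency moves from `ξ` to `k`. -/
theorem exists_decayRate_le_mul {α : ℝ → ℝ} (hα : IsDimensionFunction α) {δ : ℝ} (hδ : 0 < δ)
    (hratio : ∀ x₁ x₂ : ℝ, 0 < x₁ → x₁ ≤ x₂ → x₂ < δ → x₁ * α x₂ ≤ x₂ * α x₁) :
    ∃ T : ℝ, 1 ≤ T ∧ ∀ k ξ : ℝ, T ≤ |k| → ξ ≠ 0 →
      decayRate α k ≤ decayRate α ξ * (1 + |ξ - k|) := by
  refine ⟨max 1 (2 / δ), le_max_left _ _, fun k ξ hk hξ => ?_⟩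
  have hk1 : 1 ≤ |k| := (le_max_left _ _).trans hk
  have hk2 : 2 / δ ≤ |k| := (le_max_right _ _).trans hk
  have hk0 : 0 < |k| := by linarith
  have hξ0 : 0 < |ξ| := abs_pos.2 hξ
  rcases le_total |ξ| |k| with h | h
  · have h1 := decayRate_anti hα hξ h
    have := decayRate_nonneg α ξ
    have := abs_nonneg (ξ - k)
    nlinarith
  · have h1 : 1 / |k| < δ := by
      rw [div_le_iff₀ hδ] at hk2
      rw [div_lt_iff₀ hk0]; nlinarith
    have h2 := hratio (1 / |ξ|) (1 / |k|) (by positivity) (one_div_le_one_div_of_le hk0 h) h1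
    have h3 : |k| * α (1 / |k|) ≤ |ξ| * α (1 / |ξ|) := by
      have : |k| * α (1 / |k|) = (|k| * |ξ|) * (1 / |ξ| * α (1 / |k|)) := by field_simp
      rw [this]
      have : |ξ| * α (1 / |ξ|) = (|k| * |ξ|) * (1 / |k| * α (1 / |ξ|)) := by field_simp
      rw [this]
      gcongr
    have h4 : |ξ| ≤ |k| * (1 + |ξ - k|) := by
      have : |ξ| ≤ |k| + |ξ - k| := by
        have := abs_add_le k (ξ - k); simpa using this
      nlinarith [abs_nonneg (ξ - k)]
    have h5 : α (1 / |k|) ≤ α (1 / |ξ|) * (1 + |ξ - k|) := by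
      have := hα.pos (1 / |ξ|) (by positivity)
      refine le_of_mul_le_mul_left (h3.trans ?_) hk0
      nlinarith
    have h6 : α (1 / |k|) ≤ α (1 / |ξ|) * (1 + |ξ - k|) ^ 2 := by
      have := hα.pos (1 / |ξ|) (by positivity)
      refine h5.trans (mul_le_mul_of_nonneg_left ?_ this.le)
      nlinarith [abs_nonneg (ξ - k)]
    calc decayRate α k ≤ Real.sqrt (α (1 / |ξ|) * (1 + |ξ - k|) ^ 2) := Real.sqrt_le_sqrt h6
      _ = _ := by rw [Real.sqrt_mul' _ (by positivity), Real.sqrt_sq (by positivity)]; rfl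

/-- The radius `ψ(q) = α⁻¹(q⁻²)` attached to the denominator `q`. -/
noncomputable def approxRadius (α : ℝ → ℝ) (q : ℕ) : ℝ := increasingInverse α (((q : ℝ) ^ 2)⁻¹)

theorem eventually_inv_sq_le {c : ℝ} (hc : 0 < c) : ∀ᶠ q : ℕ in atTop, ((q : ℝ) ^ 2)⁻¹ ≤ c := by
  have : Tendsto (fun q : ℕ => ((q : ℝ) ^ 2)⁻¹) atTop (𝓝 0) :=
    tendsto_inv_atTop_zero.comp ((tendsto_pow_atTop two_ne_zero).comp tendsto_natCast_atTop_atTop)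
  exact this.eventually_le_const hc

theorem eventually_approxRadius_le {α : ℝ → ℝ} (hα : IsDimensionFunction α) {ε : ℝ}
    (hε : 0 < ε) : ∀ᶠ q : ℕ in atTop, approxRadius α q ≤ ε := by
  filter_upwards [eventually_inv_sq_le (hα.pos ε hε)] with q hq
  exact csInf_le ⟨0, fun x hx => hx.1.le⟩ ⟨hε, hq⟩

theorem approxRadius_pos {α : ℝ → ℝ} (hα : IsDimensionFunction α) {q : ℕ} (hq : 0 < q)
    (hq' : ((q : ℝ) ^ 2)⁻¹ ≤ α 1) : 0 < approxRadius α q := by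
  have h0 : (0 : ℝ) < ((q : ℝ) ^ 2)⁻¹ := by positivity
  have h1 := hα.tendsto_zero.eventually (gt_mem_nhds h0)
  obtain ⟨u, hu, hlt⟩ := (mem_nhdsGT_iff_exists_Ioo_subset).1 h1
  refine lt_of_lt_of_le hu (le_csInf ⟨1, one_pos, hq'⟩ fun x hx => ?_)
  by_contra! hxu
  exact absurd (hlt ⟨hx.1, hxu⟩) (not_lt.2 hx.2)

/-- The relation `α(ψ(q)) = q⁻²`, up to constants; in this form it needs no continuity of `α`. -/
theorem eventually_approxRadius_bounds {α : ℝ → ℝ} (hα : IsDimensionFunction α) {δ : ℝ}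
    (hδ : 0 < δ)
    (hratio : ∀ x₁ x₂ : ℝ, 0 < x₁ → x₁ ≤ x₂ → x₂ < δ → x₁ * α x₂ ≤ x₂ * α x₁) :
    ∀ᶠ q : ℕ in atTop, 0 < approxRadius α q ∧ ((q : ℝ) ^ 2)⁻¹ ≤ 2 * α (approxRadius α q) ∧
      α (2 * approxRadius α q) ≤ 4 * ((q : ℝ) ^ 2)⁻¹ := by
  filter_upwards [eventually_inv_sq_le (hα.pos 1 one_pos), eventually_gt_atTop 0,
    eventually_approxRadius_le hα (show 0 < δ / 3 by positivity)] with q hq1 hq0 hqδ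
  have hpos := approxRadius_pos hα hq0 hq1
  set ψ := approxRadius α q
  refine ⟨hpos, ?_, ?_⟩
  · have h1 : ((q : ℝ) ^ 2)⁻¹ ≤ α (2 * ψ) := by
      obtain ⟨y, hy, hlt⟩ := exists_lt_of_csInf_lt
        (s := {x : ℝ | 0 < x ∧ ((q : ℝ) ^ 2)⁻¹ ≤ α x}) ⟨1, one_pos, hq1⟩
        (show sInf _ < 2 * ψ by change ψ < _; linarith)
      exact hy.2.trans (hα.mono hy.1 (show 0 < 2 * ψ by positivity) hlt.le)
    have h2 := hratio ψ (2 * ψ) hpos (by linarith) (by linarith)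
    refine h1.trans (le_of_mul_le_mul_left ?_ hpos)
    linarith
  · have h1 : α (ψ / 2) ≤ ((q : ℝ) ^ 2)⁻¹ := by
      by_contra! h
      have : ψ ≤ ψ / 2 := csInf_le ⟨0, fun x hx => hx.1.le⟩ ⟨by positivity, h.le⟩
      linarith
    have h2 := hratio (ψ / 2) (2 * ψ) (by positivity) (by linarith) (by linarith)
    have h3 : α (2 * ψ) ≤ 4 * α (ψ / 2) := by
      refine le_of_mul_le_mul_left ?_ (show 0 < ψ / 2 by positivity)
      linarith
    linarith

theorem eventually_gauge_le_rpow {α : ℝ → ℝ} (hα : IsDimensionFunction α) {ν : ℝ} (hν : 0 < ν)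
    (hlim : Tendsto (fun x : ℝ => Real.log (α x) / Real.log x) (𝓝[>] 0) (𝓝 ν)) :
    ∃ δ : ℝ, 0 < δ ∧ ∀ x : ℝ, 0 < x → x < δ → α x ≤ x ^ (ν / 2) := by
  have h1 := hlim.eventually (lt_mem_nhds (show ν / 2 < ν by linarith))
  have h2 : ∀ᶠ x : ℝ in 𝓝[>] 0, x < 1 := nhdsWithin_le_nhds (gt_mem_nhds one_pos)
  obtain ⟨u, hu, hlt⟩ := (mem_nhdsGT_iff_exists_Ioo_subset).1 (h1.and h2)
  refine ⟨u, hu, fun x hx hxu => ?_⟩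
  obtain ⟨h3, h4⟩ := hlt ⟨hx, hxu⟩
  have hlog : Real.log x < 0 := Real.log_neg hx h4
  have h5 : Real.log (α x) < ν / 2 * Real.log x := by
    have h6 : ν / 2 < Real.log (α x) / Real.log x := h3
    rwa [lt_div_iff_of_neg hlog] at h6
  rw [← Real.log_le_log_iff (hα.pos x hx) (by positivity), Real.log_rpow hx]
  exact h5.le

/-- The radii decay at most polynomially. -/
theorem exists_eventually_inv_pow_le_approxRadius {α : ℝ → ℝ} (hα : IsDimensionFunction α)
    {ν : ℝ} (hν : 0 < ν)
    (hlim : Tendsto (fun x : ℝ => Real.log (α x) / Real.log x) (𝓝[>] 0) (𝓝 ν)) {δ : ℝ}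
    (hδ : 0 < δ)
    (hratio : ∀ x₁ x₂ : ℝ, 0 < x₁ → x₁ ≤ x₂ → x₂ < δ → x₁ * α x₂ ≤ x₂ * α x₁) :
    ∃ B : ℕ, 0 < B ∧ ∀ᶠ q : ℕ in atTop, ((q : ℝ) ^ B)⁻¹ ≤ approxRadius α q := by
  obtain ⟨u, hu, hle⟩ := eventually_gauge_le_rpow hα hν hlim
  obtain ⟨B, hB⟩ := exists_nat_gt (6 / ν)
  refine ⟨B, Nat.cast_pos.1 ((by positivity : 0 < 6 / ν).trans hB), ?_⟩
  filter_upwards [eventually_approxRadius_bounds hα hδ hratio, eventually_ge_atTop 2,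
    eventually_approxRadius_le hα (show 0 < u / 2 by positivity)] with q hq hq2 hqu
  obtain ⟨hpos, h1, -⟩ := hq
  have h2 := hle _ hpos (by linarith)
  have hq2' : (2 : ℝ) ≤ q := by exact_mod_cast hq2
  have hq0 : (0 : ℝ) < q := by linarith
  set ψ := approxRadius α q
  have h3 : ((q : ℝ) ^ 3)⁻¹ ≤ ψ ^ (ν / 2) := by
    have h4 : ((q : ℝ) ^ 3)⁻¹ ≤ ((q : ℝ) ^ 2)⁻¹ / 2 := by
      rw [inv_eq_one_div, inv_eq_one_div, div_div]
      apply one_div_le_one_div_of_le (by positivity)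
      nlinarith [sq_nonneg (q : ℝ)]
    linarith
  by_contra! hlt
  have h5 : ψ ^ (ν / 2) < (((q : ℝ) ^ B)⁻¹) ^ (ν / 2) :=
    Real.rpow_lt_rpow hpos.le hlt (by positivity)
  have h6 : (((q : ℝ) ^ B)⁻¹) ^ (ν / 2) ≤ ((q : ℝ) ^ 3)⁻¹ := by
    rw [Real.inv_rpow (by positivity), ← Real.rpow_natCast, ← Real.rpow_mul hq0.le,
      ← Real.rpow_natCast]
    apply inv_anti₀ (by positivity)
    apply Real.rpow_le_rpow_of_exponent_le (by linarith)
    rw [div_lt_iff₀ hν] at hB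
    push_cast
    linarith
  linarith

/-- For large `q` the weight `1/q` is controlled by the decay rate at `k`, with a loss that the
decay of a smooth bump of width `ψ(q)` absorbs. -/
theorem eventually_inv_le_decayRate {α : ℝ → ℝ} (hα : IsDimensionFunction α) {δ : ℝ}
    (hδ : 0 < δ)
    (hratio : ∀ x₁ x₂ : ℝ, 0 < x₁ → x₁ ≤ x₂ → x₂ < δ → x₁ * α x₂ ≤ x₂ * α x₁) :
    ∀ᶠ q : ℕ in atTop, ∀ k : ℝ, k ≠ 0 →
      (q : ℝ)⁻¹ ≤ 2 * decayRate α k * (1 + approxRadius α q * |k|) := by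
  filter_upwards [eventually_approxRadius_bounds hα hδ hratio,
    eventually_approxRadius_le hα (show 0 < δ / 2 by positivity)] with q hq hqδ k hk
  obtain ⟨hpos, h1, -⟩ := hq
  set ψ := approxRadius α q
  have hk0 : 0 < |k| := abs_pos.2 hk
  have hα0 := hα.pos (1 / |k|) (by positivity)
  have hα1 := hα.pos ψ hpos
  have h2 : α ψ ≤ α (1 / |k|) * (1 + ψ * |k|) := by
    rcases le_total ψ (1 / |k|) with h | h
    · have := hα.mono hpos (show 0 < 1 / |k| by positivity) h
      nlinarith [mul_pos hpos hk0, mul_pos hα0 (mul_pos hpos hk0)]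
    · have h3 := hratio (1 / |k|) ψ (by positivity) h (by linarith)
      have h4 : α ψ ≤ ψ * |k| * α (1 / |k|) := by
        have : α ψ = |k| * (1 / |k| * α ψ) := by field_simp
        rw [this]
        calc |k| * (1 / |k| * α ψ) ≤ |k| * (ψ * α (1 / |k|)) := by gcongr
          _ = _ := by ring
      nlinarith
  have h5 : ((q : ℝ) ^ 2)⁻¹ ≤ α (1 / |k|) * (2 * (1 + ψ * |k|)) ^ 2 := by
    have h6 : 0 < ψ * |k| := mul_pos hpos hk0
    have : α (1 / |k|) * (1 + ψ * |k|) * 2 ≤ α (1 / |k|) * (2 * (1 + ψ * |k|)) ^ 2 := by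
      rw [mul_assoc]
      apply mul_le_mul_of_nonneg_left _ hα0.le
      nlinarith
    linarith
  have h7 := Real.sqrt_le_sqrt h5
  rw [Real.sqrt_mul' _ (by positivity), Real.sqrt_sq (by positivity), ← inv_pow,
    Real.sqrt_sq (by positivity)] at h7
  calc (q : ℝ)⁻¹ ≤ _ := h7
    _ = _ := by unfold decayRate; ring

/-- A nonzero integer `n` has a bounded number of prime divisors above a fixed power of `n`, and
the smaller ones contribute little; so the sum is bounded without logarithmic loss. -/
theorem sum_prime_divisors_min_le (P : Finset ℕ) (hP : ∀ p ∈ P, p.Prime) {B n : ℕ}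
    (hB : 0 < B) (hn : 0 < n) :
    ∑ p ∈ P with p ∣ n, min 1 ((p : ℝ) ^ B / n) ≤ 2 * B + 1 := by
  have hn' : (0 : ℝ) < n := by exact_mod_cast hn
  set Q := P.filter (· ∣ n)
  have hQ : ∀ p ∈ Q, p.Prime ∧ p ∣ n := fun p hp =>
    ⟨hP p (Finset.mem_filter.1 hp).1, (Finset.mem_filter.1 hp).2⟩
  rw [← Finset.sum_filter_add_sum_filter_not Q (fun p => n ≤ p ^ (2 * B))]
  apply add_le_add
  · -- large primes: their product divides `n`
    set L := Q.filter (fun p => n ≤ p ^ (2 * B))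
    have h1 : ∑ p ∈ L, min 1 ((p : ℝ) ^ B / n) ≤ L.card := by
      calc _ ≤ ∑ p ∈ L, (1 : ℝ) := Finset.sum_le_sum fun p _ => min_le_left _ _
        _ = _ := by simp
    refine h1.trans ?_
    have hdvd : ∏ p ∈ L, p ∣ n := Finset.prod_primes_dvd n
      (fun p hp => (hQ p (Finset.mem_filter.1 hp).1).1.prime)
      (fun p hp => (hQ p (Finset.mem_filter.1 hp).1).2)
    have h2 : n ^ L.card ≤ n ^ (2 * B) := by
      calc n ^ L.card = ∏ p ∈ L, n := by simp
        _ ≤ ∏ p ∈ L, p ^ (2 * B) := Finset.prod_le_prod' fun p hp => (Finset.mem_filter.1 hp).2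
        _ = (∏ p ∈ L, p) ^ (2 * B) := Finset.prod_pow _ _ _
        _ ≤ n ^ (2 * B) := Nat.pow_le_pow_left (Nat.le_of_dvd hn hdvd) _
    rcases Nat.lt_or_ge 1 n with h | h
    · exact_mod_cast (Nat.pow_le_pow_iff_right h).1 h2
    · have : L = ∅ := by
        apply Finset.eq_empty_of_forall_notMem
        intro p hp
        have h3 := hQ p (Finset.mem_filter.1 hp).1
        have : n = 1 := by omega
        rw [this, Nat.dvd_one] at h3
        exact h3.1.one_lt.ne' h3.2
      rw [this]; simp
  · set Q' := Q.filter (fun p => ¬ n ≤ p ^ (2 * B))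
    have hsq : ∀ p ∈ Q', (p : ℝ) ^ B ≤ Real.sqrt n := fun p hp => by
      apply Real.le_sqrt_of_sq_le
      have := (not_le.1 (Finset.mem_filter.1 hp).2).le
      rw [← pow_mul, mul_comm]
      exact_mod_cast this
    have hcard : (Q'.card : ℝ) ≤ Real.sqrt n := by
      have h1 : Q' ⊆ Finset.Icc 1 ⌊Real.sqrt n⌋₊ := by
        intro p hp
        have hp1 := (hQ p (Finset.mem_filter.1 hp).1).1.one_lt
        refine Finset.mem_Icc.2 ⟨hp1.le, Nat.le_floor ((?_ : (p : ℝ) ≤ p ^ B).trans (hsq p hp))⟩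
        exact_mod_cast Nat.le_self_pow hB.ne' p
      have h2 := Finset.card_le_card h1
      rw [Nat.card_Icc, Nat.add_sub_cancel] at h2
      exact (Nat.cast_le.2 h2).trans (Nat.floor_le (Real.sqrt_nonneg _))
    calc ∑ p ∈ Q', min 1 ((p : ℝ) ^ B / n) ≤ ∑ p ∈ Q', Real.sqrt n / n :=
          Finset.sum_le_sum fun p hp => (min_le_right _ _).trans (by gcongr; exact hsq p hp)
      _ = Q'.card * (Real.sqrt n / n) := by simp
      _ ≤ Real.sqrt n * (Real.sqrt n / n) := by gcongr
      _ = 1 := by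
        rw [← mul_div_assoc, Real.mul_self_sqrt hn'.le, div_self hn'.ne']

/-! ### Fourier transforms and combs of bumps -/

/-- The Fourier transform `ξ ↦ ∫ e^{-2πixξ} f(x) dx` of a real-valued function. -/
noncomputable def realFourier (f : ℝ → ℝ) (ξ : ℝ) : ℂ := 𝓕 (fun x => (f x : ℂ)) ξ

theorem realFourier_eq (f : ℝ → ℝ) (ξ : ℝ) :
    realFourier f ξ = ∫ x : ℝ, Complex.exp (-2 * Real.pi * Complex.I * x * ξ) * (f x : ℂ) := by
  rw [realFourier, Real.fourier_real_eq_integral_exp_smul]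
  congr 1; ext x
  rw [smul_eq_mul]; congr 2; push_cast; ring

theorem norm_exp_two_pi_mul (k x : ℝ) :
    ‖Complex.exp (2 * Real.pi * Complex.I * k * x)‖ = 1 := by
  have : (2 * Real.pi * Complex.I * k * x : ℂ) = ((2 * Real.pi * k * x : ℝ) : ℂ) * Complex.I := by
    push_cast; ring
  rw [this, Complex.norm_exp_ofReal_mul_I]

theorem ContDiff.toSchwartz_ofReal {f : ℝ → ℝ} (hf : ContDiff ℝ (⊤ : ℕ∞) f) (hc : HasCompactSupport f) :
    ∃ g : 𝓢(ℝ, ℂ), ∀ x, g x = (f x : ℂ) := by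
  have h1 : HasCompactSupport (fun x => (f x : ℂ)) :=
    hc.comp_left (g := fun y : ℝ => (y : ℂ)) (by simp)
  have h2 : ContDiff ℝ (⊤ : ℕ∞) (fun x => (f x : ℂ)) := Complex.ofRealCLM.contDiff.comp hf
  exact ⟨h1.toSchwartzMap h2, fun x => rfl⟩

theorem exists_norm_realFourier_le {f : ℝ → ℝ} (hf : ContDiff ℝ (⊤ : ℕ∞) f) (hc : HasCompactSupport f)
    (N : ℕ) : ∃ D : ℝ, 0 < D ∧ ∀ t, ‖realFourier f t‖ ≤ D / (1 + |t|) ^ N := by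
  obtain ⟨g, hg⟩ := hf.toSchwartz_ofReal hc
  have hg' : ∀ t, realFourier f t = (𝓕 g : 𝓢(ℝ, ℂ)) t := fun t => by
    have : (fun x => (f x : ℂ)) = g := by ext x; exact (hg x).symm
    rw [realFourier, this]; rfl
  set C := 2 ^ N * ((Finset.Iic (N, 0)).sup fun m => SchwartzMap.seminorm ℝ m.1 m.2) (𝓕 g : 𝓢(ℝ, ℂ))
  have hC : 0 ≤ C := by positivity
  refine ⟨C + 1, by positivity, fun t => ?_⟩
  have h := SchwartzMap.one_add_le_sup_seminorm_apply (𝕜 := ℝ) (m := (N, 0)) le_rfl le_rfl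
    (𝓕 g : 𝓢(ℝ, ℂ)) t
  rw [norm_iteratedFDeriv_zero, Real.norm_eq_abs] at h
  rw [le_div_iff₀ (by positivity), hg']
  calc _ = (1 + |t|) ^ N * ‖(𝓕 g : 𝓢(ℝ, ℂ)) t‖ := mul_comm _ _
    _ ≤ C := h
    _ ≤ C + 1 := by linarith

/-- Poisson summation for the bump `y ↦ s⁻¹ φ(y / s)`. -/
theorem tsum_dilate_eq_tsum_realFourier {φ : ℝ → ℝ} (hf : ContDiff ℝ (⊤ : ℕ∞) φ)
    (hc : HasCompactSupport φ) {s : ℝ} (hs : 0 < s) (x : ℝ) :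
    ((∑' n : ℤ, s⁻¹ * φ ((x + n) / s) : ℝ) : ℂ) =
      ∑' n : ℤ, realFourier φ (s * n) * Complex.exp (2 * Real.pi * Complex.I * n * x) := by
  have h1 : ContDiff ℝ (⊤ : ℕ∞) (fun y => s⁻¹ * φ (y / s)) := by fun_prop
  have h2 : HasCompactSupport (fun y => s⁻¹ * φ (y / s)) := by
    have : HasCompactSupport (fun y => φ (s⁻¹ • y)) :=
      hc.comp_smul (c := s⁻¹) (inv_ne_zero hs.ne')
    have h3 := this.mul_left (f := fun _ => s⁻¹)
    have h4 : (fun y => s⁻¹ * φ (y / s)) = (fun _ => s⁻¹) * fun y => φ (s⁻¹ • y) := by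
      ext y; simp [div_eq_inv_mul]
    rw [h4]; exact h3
  obtain ⟨g, hg⟩ := h1.toSchwartz_ofReal h2
  have h4 := SchwartzMap.tsum_eq_tsum_fourier g x
  rw [Complex.ofReal_tsum]
  simp_rw [hg] at h4
  rw [h4]
  refine tsum_congr fun n => ?_
  rw [fourier_coe_apply]
  congr 1
  · have h5 : (𝓕 g : 𝓢(ℝ, ℂ)) (n : ℝ) = realFourier (fun y => s⁻¹ * φ (y / s)) n := by
      have : (fun x => ((s⁻¹ * φ (x / s) : ℝ) : ℂ)) = g := by ext x; exact (hg x).symm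
      rw [realFourier, this]; rfl
    change (𝓕 g : 𝓢(ℝ, ℂ)) (n : ℝ) = _
    rw [h5, realFourier_eq, realFourier_eq]
    have h6 := Measure.integral_comp_div
      (fun x : ℝ => Complex.exp (-2 * Real.pi * Complex.I * x * (s * n : ℝ)) * (φ x : ℂ)) s
    rw [abs_of_pos hs] at h6
    have h7 : ∫ x : ℝ, Complex.exp (-2 * Real.pi * Complex.I * x * (s * n : ℝ)) * (φ x : ℂ)
        = s⁻¹ • ∫ x : ℝ, Complex.exp (-2 * Real.pi * Complex.I * (x / s : ℝ) * (s * n : ℝ)) *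
          (φ (x / s) : ℂ) := by
      rw [h6, smul_smul, inv_mul_cancel₀ hs.ne', one_smul]
    rw [h7, ← integral_smul]
    congr 1; ext y
    have : (-2 * Real.pi * Complex.I * (y / s : ℝ) * (s * n : ℝ) : ℂ) =
        -2 * Real.pi * Complex.I * y * (n : ℝ) := by
      have : (s : ℂ) ≠ 0 := by exact_mod_cast hs.ne'
      push_cast; field_simp
    rw [this, Complex.real_smul]; push_cast; ring
  · simp

/-- The Fourier coefficients of `x ↦ ∑_a (p r)⁻¹ φ((x - a/p) / r)`. -/
noncomputable def combCoeff (φ : ℝ → ℝ) (p : ℕ) (r : ℝ) (k : ℤ) : ℂ :=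
  if (p : ℤ) ∣ k then realFourier φ (r * k) else 0

theorem tsum_combCoeff (φ : ℝ → ℝ) {p : ℕ} (hp : 0 < p) (r x : ℝ) :
    ∑' k : ℤ, combCoeff φ p r k * Complex.exp (2 * Real.pi * Complex.I * k * x) =
      ∑' n : ℤ, realFourier φ (p * r * n) *
        Complex.exp (2 * Real.pi * Complex.I * n * (p * x : ℝ)) := by
  have hp' : (p : ℤ) ≠ 0 := by exact_mod_cast hp.ne'
  rw [← (mul_right_injective₀ hp').tsum_eq]
  · refine tsum_congr fun n => ?_
    rw [combCoeff, if_pos (dvd_mul_right _ _)]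
    congr 2
    · push_cast; ring
    · push_cast; ring
  · intro k hk
    by_contra h
    apply hk
    have : ¬ (p : ℤ) ∣ k := fun ⟨m, hm⟩ => h ⟨m, hm.symm⟩
    simp [combCoeff, this]

theorem summable_inv_one_add_abs_sq : Summable fun k : ℤ => ((1 + |(k : ℝ)|) ^ 2)⁻¹ := by
  have h := (Real.summable_abs_int_rpow (b := 2) one_lt_two)
  refine Summable.of_norm_bounded_eventually (g := fun k : ℤ => |(k : ℝ)| ^ (-2 : ℝ)) h ?_
  rw [eventually_cofinite]
  refine (Set.finite_singleton (0 : ℤ)).subset fun k hk => ?_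
  by_contra h0
  apply hk
  have : (0 : ℝ) < |(k : ℝ)| := by
    have : (k : ℝ) ≠ 0 := by exact_mod_cast h0
    positivity
  rw [Real.norm_of_nonneg (by positivity), Real.rpow_neg this.le]
  norm_cast
  apply inv_anti₀
  · push_cast; positivity
  · push_cast
    gcongr
    linarith

theorem exists_tsum_inv_sq_le : ∃ W : ℝ, 0 < W ∧ ∀ ξ : ℝ,
    (Summable fun k : ℤ => ((1 + |ξ - k|) ^ 2)⁻¹) ∧ ∑' k : ℤ, ((1 + |ξ - k|) ^ 2)⁻¹ ≤ W := by
  set W := ∑' k : ℤ, ((1 + |(k : ℝ)|) ^ 2)⁻¹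
  have hW : 0 ≤ W := tsum_nonneg fun k => by positivity
  refine ⟨4 * W + 1, by positivity, fun ξ => ?_⟩
  -- after translation by `⌊ξ⌋` one may compare with the sum at `ξ = 0`
  have hbd : ∀ k : ℤ, ((1 + |ξ - (k + ⌊ξ⌋ : ℤ)|) ^ 2)⁻¹ ≤ 4 * ((1 + |(k : ℝ)|) ^ 2)⁻¹ := by
    intro k
    have h1 := Int.fract_nonneg ξ
    have h2 := Int.fract_lt_one ξ
    have h3 : ξ - (k + ⌊ξ⌋ : ℤ) = Int.fract ξ - k := by
      rw [← Int.self_sub_floor]; push_cast; ring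
    have h4 : |(k : ℝ)| ≤ |Int.fract ξ - k| + 1 := by
      have := abs_sub_abs_le_abs_sub (k : ℝ) (Int.fract ξ)
      rw [abs_sub_comm, abs_of_nonneg h1] at this
      linarith
    rw [h3, ← div_eq_mul_inv, inv_eq_one_div, div_le_div_iff₀ (by positivity) (by positivity)]
    nlinarith [abs_nonneg (Int.fract ξ - k), abs_nonneg (k : ℝ)]
  have hs : Summable fun k : ℤ => ((1 + |ξ - (k + ⌊ξ⌋ : ℤ)|) ^ 2)⁻¹ :=
    Summable.of_nonneg_of_le (fun k => by positivity) hbd (summable_inv_one_add_abs_sq.mul_left 4)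
  refine ⟨(Equiv.addRight ⌊ξ⌋).summable_iff.1 hs, ?_⟩
  rw [← (Equiv.addRight ⌊ξ⌋).tsum_eq]
  calc _ ≤ ∑' k : ℤ, 4 * ((1 + |(k : ℝ)|) ^ 2)⁻¹ :=
        hs.tsum_le_tsum hbd (summable_inv_one_add_abs_sq.mul_left 4)
    _ = 4 * W := tsum_mul_left
    _ ≤ _ := by linarith

/-- Peetre's inequality. -/
theorem one_add_abs_le_mul (x y : ℝ) : 1 + |x| ≤ (1 + |x - y|) * (1 + |y|) := by
  have : |x| ≤ |x - y| + |y| := by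
    have := abs_add_le (x - y) y; simpa using this
  nlinarith [abs_nonneg (x - y), abs_nonneg y]

theorem summable_combCoeff_mul {φ : ℝ → ℝ} (hf : ContDiff ℝ (⊤ : ℕ∞) φ) (hc : HasCompactSupport φ)
    (p : ℕ) {r : ℝ} (hr : 0 < r) :
    Summable fun k : ℤ => ‖combCoeff φ p r k‖ * (1 + |(k : ℝ)|) ^ 3 := by
  obtain ⟨D, hD, hφ⟩ := exists_norm_realFourier_le hf hc 5
  refine Summable.of_nonneg_of_le (fun k => by positivity) (fun k => ?_)
    (summable_inv_one_add_abs_sq.mul_left (D * (1 + r⁻¹) ^ 5))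
  have h1 : ‖combCoeff φ p r k‖ ≤ D / (1 + |r * k|) ^ 5 := by
    unfold combCoeff
    split_ifs
    · exact hφ _
    · rw [norm_zero]; positivity
  have h2 : 1 + |(k : ℝ)| ≤ (1 + r⁻¹) * (1 + |r * k|) := by
    rw [abs_mul, abs_of_pos hr]
    have : r⁻¹ * (r * |(k : ℝ)|) = |(k : ℝ)| := by field_simp
    have : 0 < r⁻¹ := by positivity
    nlinarith [mul_nonneg hr.le (abs_nonneg (k : ℝ))]
  have h3 : (1 + |(k : ℝ)|) ^ 5 ≤ (1 + r⁻¹) ^ 5 * (1 + |r * k|) ^ 5 := by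
    rw [← mul_pow]; gcongr
  have h4 : D / (1 + |r * k|) ^ 5 ≤ D * (1 + r⁻¹) ^ 5 / (1 + |(k : ℝ)|) ^ 5 := by
    rw [div_le_div_iff₀ (by positivity) (by positivity), mul_assoc]
    gcongr
  calc ‖combCoeff φ p r k‖ * (1 + |(k : ℝ)|) ^ 3
      ≤ D * (1 + r⁻¹) ^ 5 / (1 + |(k : ℝ)|) ^ 5 * (1 + |(k : ℝ)|) ^ 3 := by
        gcongr; exact h1.trans h4
    _ = _ := by field_simp

/-- Smooth bumps of width `r` around the fractions `a / p`, normalised to have mean value `1`. -/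
noncomputable def comb (φ : ℝ → ℝ) (p : ℕ) (r x : ℝ) : ℝ :=
  ∑' n : ℤ, (p * r)⁻¹ * φ ((p * x + n) / (p * r))

theorem comb_eq_tsum {φ : ℝ → ℝ} (hf : ContDiff ℝ (⊤ : ℕ∞) φ) (hc : HasCompactSupport φ)
    {p : ℕ} (hp : 0 < p) {r : ℝ} (hr : 0 < r) (x : ℝ) :
    (comb φ p r x : ℂ) =
      ∑' k : ℤ, combCoeff φ p r k * Complex.exp (2 * Real.pi * Complex.I * k * x) := by
  have hp' : (0 : ℝ) < p := by exact_mod_cast hp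
  rw [tsum_combCoeff φ hp, comb, tsum_dilate_eq_tsum_realFourier hf hc (by positivity)]

theorem comb_nonneg {φ : ℝ → ℝ} (h0 : ∀ x, 0 ≤ φ x) (p : ℕ) {r : ℝ} (hr : 0 < r) (x : ℝ) :
    0 ≤ comb φ p r x :=
  tsum_nonneg fun n => mul_nonneg (by positivity) (h0 _)

theorem exists_abs_sub_le_of_comb_ne_zero {φ : ℝ → ℝ} (hφ : ∀ x, φ x ≠ 0 → |x| ≤ 1) {p : ℕ}
    (hp : 0 < p) {r : ℝ} (hr : 0 < r) {x : ℝ} (hx : comb φ p r x ≠ 0) :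
    ∃ a : ℤ, |x - (a : ℝ) / p| ≤ r := by
  have hp' : (0 : ℝ) < p := by exact_mod_cast hp
  by_contra! h
  apply hx
  rw [comb]
  convert tsum_zero with n
  by_contra hn
  have h1 := hφ _ (right_ne_zero_of_mul hn)
  have h2 := h (-n)
  rw [abs_div, abs_of_pos (show (0 : ℝ) < p * r by positivity), div_le_one (by positivity)] at h1
  have h3 : x - ((-n : ℤ) : ℝ) / p = (p * x + n) / p := by
    push_cast; field_simp; ring
  rw [h3, abs_div, abs_of_pos hp', lt_div_iff₀ hp'] at h2
  linarith

/-! ### Kernels built on primes -/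

/-- Multiplication by an absolutely convergent Fourier series convolves the Fourier transform
with its coefficients. -/
theorem hasSum_realFourier_mul {χ g : ℝ → ℝ} (hχ : Integrable χ) {c : ℤ → ℂ}
    (hc : Summable fun k => ‖c k‖)
    (hg : ∀ x : ℝ, (g x : ℂ) = ∑' k : ℤ, c k * Complex.exp (2 * Real.pi * Complex.I * k * x))
    (ξ : ℝ) : HasSum (fun k : ℤ => c k * realFourier χ (ξ - k))
      (realFourier (fun x => χ x * g x) ξ) := by
  set F : ℤ → ℝ → ℂ := fun k x =>
    c k * (Complex.exp (-2 * Real.pi * Complex.I * x * (ξ - k : ℝ)) * (χ x : ℂ))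
  have hnorm : ∀ k x, ‖F k x‖ = ‖c k‖ * |χ x| := fun k x => by
    have := norm_exp_two_pi_mul (-(ξ - k)) x
    simp only [F, norm_mul, Complex.norm_real, Real.norm_eq_abs]
    rw [show (-2 * Real.pi * Complex.I * x * (ξ - k : ℝ) : ℂ) =
      2 * Real.pi * Complex.I * (-(ξ - k) : ℝ) * x by push_cast; ring, this, one_mul]
  have hint : ∀ k, Integrable (F k) := fun k => by
    have hm : AEStronglyMeasurable (F k) volume := by
      refine AEStronglyMeasurable.const_mul (AEStronglyMeasurable.mul ?_ ?_) _
      · exact Continuous.aestronglyMeasurable (by fun_prop)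
      · exact Complex.continuous_ofReal.comp_aestronglyMeasurable hχ.1
    refine (hχ.norm.const_mul ‖c k‖).mono hm (Eventually.of_forall fun x => ?_)
    rw [hnorm]; simp
  have h := hasSum_integral_of_summable_integral_norm hint (by
    simp_rw [hnorm, integral_const_mul]
    exact hc.mul_right _)
  have h1 : ∀ k, ∫ x, F k x = c k * realFourier χ (ξ - k) := fun k => by
    rw [realFourier_eq, ← integral_const_mul]
  have h2 : ∫ x, ∑' k, F k x = realFourier (fun x => χ x * g x) ξ := by
    rw [realFourier_eq]
    congr 1; ext x
    push_cast
    rw [hg, ← tsum_mul_left, ← tsum_mul_left]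
    refine tsum_congr fun k => ?_
    have : Complex.exp (-2 * Real.pi * Complex.I * x * (ξ - k : ℝ)) =
        Complex.exp (-2 * Real.pi * Complex.I * x * ξ) *
          Complex.exp (2 * Real.pi * Complex.I * k * x) := by
      rw [← Complex.exp_add]; congr 1; push_cast; ring
    simp only [F]
    rw [this]; ring
  simpa only [h1, h2] using h

/-- The densities of the approximating measures: continuous, nonnegative, carried by `[0, 1]`, with
a Fourier transform decaying like `|ξ|⁻³`. Asking for this decay instead of smoothness makes the
class visibly stable under multiplication by Fourier series with rapidly decaying coefficients. -/
structure IsAmplitude (χ : ℝ → ℝ) : Prop where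
  continuous : Continuous χ
  nonneg : ∀ x, 0 ≤ χ x
  mem_Icc : ∀ x, χ x ≠ 0 → x ∈ Set.Icc (0 : ℝ) 1
  decay : ∃ D : ℝ, 0 < D ∧ ∀ ξ, ‖realFourier χ ξ‖ ≤ D / (1 + |ξ|) ^ 3

theorem IsAmplitude.integrable {χ : ℝ → ℝ} (h : IsAmplitude χ) : Integrable χ :=
  h.continuous.integrable_of_hasCompactSupport
    (HasCompactSupport.intro isCompact_Icc fun x hx => by_contra fun hn => hx (h.mem_Icc x hn))

theorem IsAmplitude.mul {χ g : ℝ → ℝ} (h : IsAmplitude χ) (hgc : Continuous g)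
    (hg0 : ∀ x, 0 ≤ g x) {c : ℤ → ℂ} (hc : Summable fun k : ℤ => ‖c k‖ * (1 + |(k : ℝ)|) ^ 3)
    (hg : ∀ x : ℝ, (g x : ℂ) = ∑' k : ℤ, c k * Complex.exp (2 * Real.pi * Complex.I * k * x)) :
    IsAmplitude fun x => χ x * g x := by
  refine ⟨h.continuous.mul hgc, fun x => mul_nonneg (h.nonneg x) (hg0 x),
    fun x hx => h.mem_Icc x (left_ne_zero_of_mul hx), ?_⟩
  obtain ⟨D, hD, hdec⟩ := h.decay
  have hc' : Summable fun k => ‖c k‖ := hc.of_nonneg_of_le (fun k => norm_nonneg _)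
    fun k => le_mul_of_one_le_right (norm_nonneg _) (one_le_pow₀ (by
      linarith [abs_nonneg (k : ℝ)]))
  set A := ∑' k : ℤ, ‖c k‖ * (1 + |(k : ℝ)|) ^ 3
  have hA : 0 ≤ A := tsum_nonneg fun k => by positivity
  refine ⟨A * D + 1, by positivity, fun ξ => ?_⟩
  rw [← (hasSum_realFourier_mul h.integrable hc' hg ξ).tsum_eq]
  have hs : Summable fun k : ℤ => ‖c k‖ * (1 + |(k : ℝ)|) ^ 3 * (D / (1 + |ξ|) ^ 3) :=
    hc.mul_right _
  refine (tsum_of_norm_bounded hs.hasSum fun k => ?_).trans ?_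
  · rw [norm_mul, mul_assoc]
    apply mul_le_mul_of_nonneg_left _ (norm_nonneg _)
    refine (hdec _).trans ?_
    rw [mul_div_assoc', div_le_div_iff₀ (by positivity) (by positivity)]
    have := one_add_abs_le_mul ξ k
    calc D * (1 + |ξ|) ^ 3 ≤ D * ((1 + |ξ - k|) * (1 + |(k : ℝ)|)) ^ 3 := by gcongr
      _ = _ := by ring
  · rw [tsum_mul_right, mul_div_assoc']
    gcongr
    linarith

/-- The average of the combs of denominators `p ∈ P`, with weights proportional to `1 / p`. -/
noncomputable def primeKernel (φ : ℝ → ℝ) (ψ : ℕ → ℝ) (P : Finset ℕ) (x : ℝ) : ℝ :=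
  (∑ p ∈ P, (p : ℝ)⁻¹)⁻¹ * ∑ p ∈ P, (p : ℝ)⁻¹ * comb φ p (ψ p) x

/-- The Fourier coefficients of `primeKernel`. -/
noncomputable def kernelCoeff (φ : ℝ → ℝ) (ψ : ℕ → ℝ) (P : Finset ℕ) (k : ℤ) : ℂ :=
  ((∑ p ∈ P, (p : ℝ)⁻¹)⁻¹ : ℝ) * ∑ p ∈ P, ((p : ℝ)⁻¹ : ℝ) * combCoeff φ p (ψ p) k

theorem norm_kernelCoeff_le (φ : ℝ → ℝ) (ψ : ℕ → ℝ) (P : Finset ℕ) (k : ℤ) :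
    ‖kernelCoeff φ ψ P k‖ ≤
      (∑ p ∈ P, (p : ℝ)⁻¹)⁻¹ * ∑ p ∈ P, (p : ℝ)⁻¹ * ‖combCoeff φ p (ψ p) k‖ := by
  have hS : 0 ≤ ∑ p ∈ P, (p : ℝ)⁻¹ := Finset.sum_nonneg fun p _ => by positivity
  rw [kernelCoeff, norm_mul, Complex.norm_real, Real.norm_of_nonneg (inv_nonneg.2 hS)]
  gcongr
  refine (norm_sum_le _ _).trans (Finset.sum_le_sum fun p _ => ?_)
  rw [norm_mul, Complex.norm_real, Real.norm_of_nonneg (by positivity)]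

theorem summable_kernelCoeff_mul {φ : ℝ → ℝ} (hf : ContDiff ℝ (⊤ : ℕ∞) φ) (hc : HasCompactSupport φ)
    {ψ : ℕ → ℝ} {P : Finset ℕ} (hψ : ∀ p ∈ P, 0 < ψ p) :
    Summable fun k : ℤ => ‖kernelCoeff φ ψ P k‖ * (1 + |(k : ℝ)|) ^ 3 := by
  have h : Summable fun k : ℤ => (∑ p ∈ P, (p : ℝ)⁻¹)⁻¹ *
      ∑ p ∈ P, (p : ℝ)⁻¹ * (‖combCoeff φ p (ψ p) k‖ * (1 + |(k : ℝ)|) ^ 3) :=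
    (summable_sum fun p hp => (summable_combCoeff_mul hf hc p (hψ p hp)).mul_left _).mul_left _
  refine Summable.of_nonneg_of_le (fun k => by positivity) (fun k => ?_) h
  refine (mul_le_mul_of_nonneg_right (norm_kernelCoeff_le φ ψ P k) (by positivity)).trans_eq ?_
  rw [mul_assoc, Finset.sum_mul]
  simp_rw [mul_assoc]

theorem primeKernel_eq_tsum {φ : ℝ → ℝ} (hf : ContDiff ℝ (⊤ : ℕ∞) φ) (hc : HasCompactSupport φ)
    {ψ : ℕ → ℝ} {P : Finset ℕ} (hP : ∀ p ∈ P, 0 < p) (hψ : ∀ p ∈ P, 0 < ψ p) (x : ℝ) :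
    (primeKernel φ ψ P x : ℂ) =
      ∑' k : ℤ, kernelCoeff φ ψ P k * Complex.exp (2 * Real.pi * Complex.I * k * x) := by
  have hs : ∀ p ∈ P, Summable fun k : ℤ => ((p : ℝ)⁻¹ : ℝ) *
      (combCoeff φ p (ψ p) k * Complex.exp (2 * Real.pi * Complex.I * k * x)) := by
    intro p hp
    refine Summable.mul_left _ (Summable.of_norm ?_)
    refine (summable_combCoeff_mul hf hc p (hψ p hp)).of_nonneg_of_le (fun k => norm_nonneg _)
      fun k => ?_
    have := norm_exp_two_pi_mul k x
    rw [norm_mul]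
    push_cast at this
    rw [this, mul_one]
    exact le_mul_of_one_le_right (norm_nonneg _) (one_le_pow₀ (by
      linarith [abs_nonneg (k : ℝ)]))
  calc (primeKernel φ ψ P x : ℂ) = ((∑ p ∈ P, (p : ℝ)⁻¹)⁻¹ : ℝ) * ∑ p ∈ P, ∑' k : ℤ,
        ((p : ℝ)⁻¹ : ℝ) *
        (combCoeff φ p (ψ p) k * Complex.exp (2 * Real.pi * Complex.I * k * x)) := by
        rw [primeKernel, Complex.ofReal_mul, Complex.ofReal_sum]
        congr 1
        refine Finset.sum_congr rfl fun p hp => ?_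
        rw [Complex.ofReal_mul, comb_eq_tsum hf hc (hP p hp) (hψ p hp), tsum_mul_left]
    _ = _ := by
        rw [← Summable.tsum_finsetSum hs, ← tsum_mul_left]
        refine tsum_congr fun k => ?_
        rw [kernelCoeff]
        simp only [mul_assoc, Finset.sum_mul]

theorem continuous_primeKernel {φ : ℝ → ℝ} (hf : ContDiff ℝ (⊤ : ℕ∞) φ) (hc : HasCompactSupport φ)
    {ψ : ℕ → ℝ} {P : Finset ℕ} (hP : ∀ p ∈ P, 0 < p) (hψ : ∀ p ∈ P, 0 < ψ p) :
    Continuous (primeKernel φ ψ P) := by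
  have h : Continuous fun x : ℝ =>
      ∑' k : ℤ, kernelCoeff φ ψ P k * Complex.exp (2 * Real.pi * Complex.I * k * x) := by
    refine continuous_tsum (fun k => by fun_prop) (summable_kernelCoeff_mul hf hc hψ)
      fun k x => ?_
    have := norm_exp_two_pi_mul k x
    rw [norm_mul]
    push_cast at this
    rw [this, mul_one]
    exact le_mul_of_one_le_right (norm_nonneg _) (one_le_pow₀ (by
      linarith [abs_nonneg (k : ℝ)]))
  have h2 : primeKernel φ ψ P = fun x : ℝ => (∑' k : ℤ, kernelCoeff φ ψ P k *
      Complex.exp (2 * Real.pi * Complex.I * k * x)).re := by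
    ext x
    rw [← primeKernel_eq_tsum hf hc hP hψ, Complex.ofReal_re]
  rw [h2]
  exact Complex.continuous_re.comp h

theorem kernelCoeff_zero {φ : ℝ → ℝ} {ψ : ℕ → ℝ} {P : Finset ℕ}
    (hφ : realFourier φ 0 = 1) (hS : 0 < ∑ p ∈ P, (p : ℝ)⁻¹) :
    kernelCoeff φ ψ P 0 = 1 := by
  simp only [kernelCoeff, combCoeff, dvd_zero, if_true, Int.cast_zero, mul_zero, hφ, mul_one]
  rw [← Complex.ofReal_sum, ← Complex.ofReal_mul, inv_mul_cancel₀ hS.ne', Complex.ofReal_one]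

theorem kernelCoeff_eq_zero {φ : ℝ → ℝ} {ψ : ℕ → ℝ} {P : Finset ℕ}
    {M : ℕ} (hP : ∀ p ∈ P, M < p) {k : ℤ} (hk : k ≠ 0)
    (hkM : |(k : ℝ)| ≤ M) : kernelCoeff φ ψ P k = 0 := by
  rw [kernelCoeff]
  refine mul_eq_zero_of_right _ (Finset.sum_eq_zero fun p hp => ?_)
  rw [combCoeff, if_neg, mul_zero]
  intro hdvd
  have h1 := Int.le_of_dvd (abs_pos.2 hk) ((dvd_abs _ _).2 hdvd)
  have h2 : |k| ≤ (M : ℤ) := by exact_mod_cast hkM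
  have := hP p hp
  omega

/-- The coefficients of a kernel built on large primes are bounded by the decay rate, uniformly up
to the normalising factor. -/
theorem exists_norm_kernelCoeff_le {α : ℝ → ℝ} (hα : IsDimensionFunction α) {δ : ℝ}
    (hδ : 0 < δ)
    (hratio : ∀ x₁ x₂ : ℝ, 0 < x₁ → x₁ ≤ x₂ → x₂ < δ → x₁ * α x₂ ≤ x₂ * α x₁)
    {B : ℕ} (hB : 0 < B) (hψ : ∀ᶠ q : ℕ in atTop, ((q : ℝ) ^ B)⁻¹ ≤ approxRadius α q)
    {φ : ℝ → ℝ} (hf : ContDiff ℝ (⊤ : ℕ∞) φ) (hc : HasCompactSupport φ) :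
    ∃ K : ℝ, 0 < K ∧ ∃ M₀ : ℕ, ∀ P : Finset ℕ, (∀ p ∈ P, p.Prime ∧ M₀ ≤ p) →
      ∀ k : ℤ, k ≠ 0 → ‖kernelCoeff φ (approxRadius α) P k‖ ≤
        (∑ p ∈ P, (p : ℝ)⁻¹)⁻¹ * (K * decayRate α k) := by
  obtain ⟨D, hD, hφ⟩ := exists_norm_realFourier_le hf hc 2
  obtain ⟨M₀, hM₀⟩ := eventually_atTop.1 ((eventually_gt_atTop 0).and
    (hψ.and (eventually_inv_le_decayRate hα hδ hratio)))
  refine ⟨2 * D * (2 * B + 1), by positivity, M₀, fun P hP k hk => ?_⟩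
  have hkR : (k : ℝ) ≠ 0 := by exact_mod_cast hk
  have hk0 : 0 < |(k : ℝ)| := abs_pos.2 hkR
  have hkn : ((k.natAbs : ℕ) : ℝ) = |(k : ℝ)| := by rw [Nat.cast_natAbs]; simp
  have hβ := decayRate_nonneg α k
  have hS : 0 ≤ ∑ p ∈ P, (p : ℝ)⁻¹ := Finset.sum_nonneg fun p _ => by positivity
  refine (norm_kernelCoeff_le _ _ _ _).trans (mul_le_mul_of_nonneg_left ?_ (inv_nonneg.2 hS))
  have hterm : ∀ p ∈ P, (p : ℝ)⁻¹ * ‖combCoeff φ p (approxRadius α p) k‖ ≤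
      if p ∣ k.natAbs then 2 * D * decayRate α k * min 1 ((p : ℝ) ^ B / k.natAbs) else 0 := by
    intro p hp
    obtain ⟨hp0, hp1, hp2⟩ := hM₀ p (hP p hp).2
    by_cases hdvd : p ∣ k.natAbs
    · have hdvd' : (p : ℤ) ∣ k := Int.natCast_dvd.2 hdvd
      rw [if_pos hdvd, combCoeff, if_pos hdvd', hkn]
      have hp0' : (0 : ℝ) < (p : ℝ) := by exact_mod_cast hp0
      have hψ0 : 0 < approxRadius α p := lt_of_lt_of_le (by positivity) hp1
      set r := approxRadius α p
      have h1 := hφ (r * k)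
      rw [abs_mul, abs_of_pos hψ0] at h1
      have hu : 0 < r * |(k : ℝ)| := by positivity
      have h2 : (p : ℝ)⁻¹ * ‖realFourier φ (r * k)‖ ≤
          2 * D * decayRate α k * (1 + r * |(k : ℝ)|)⁻¹ := by
        calc _ ≤ (2 * decayRate α k * (1 + r * |(k : ℝ)|)) * (D / (1 + r * |(k : ℝ)|) ^ 2) :=
              mul_le_mul (hp2 k hkR) h1 (norm_nonneg _) (by positivity)
          _ = _ := by field_simp
      refine h2.trans (mul_le_mul_of_nonneg_left (le_min ?_ ?_) (by positivity))
      · exact inv_le_one_of_one_le₀ (by linarith)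
      · rw [inv_eq_one_div, div_le_div_iff₀ (by positivity) hk0, one_mul]
        have h3 : 1 ≤ (p : ℝ) ^ B * r := by
          rw [inv_eq_one_div, div_le_iff₀ (by positivity)] at hp1
          linarith
        calc |(k : ℝ)| ≤ (p : ℝ) ^ B * r * |(k : ℝ)| := le_mul_of_one_le_left hk0.le h3
          _ ≤ (p : ℝ) ^ B * (1 + r * |(k : ℝ)|) := by
            have : 0 < (p : ℝ) ^ B := by positivity
            nlinarith
    · have hdvd' : ¬ (p : ℤ) ∣ k := fun h => hdvd (Int.natCast_dvd.1 h)
      rw [if_neg hdvd, combCoeff, if_neg hdvd', norm_zero, mul_zero]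
  refine (Finset.sum_le_sum hterm).trans ?_
  rw [← Finset.sum_filter, ← Finset.mul_sum]
  have := sum_prime_divisors_min_le P (fun p hp => (hP p hp).1) hB (Int.natAbs_pos.2 hk)
  calc _ ≤ 2 * D * decayRate α k * (2 * B + 1) := by gcongr
    _ = _ := by ring

/-- Since `∑ 1 / p` diverges with terms tending to `0`, its finite pieces beyond any bound come
close to any prescribed positive value. -/
theorem exists_primes_sum_inv_mem {ε : ℝ} (hε : 0 < ε) (M : ℕ) :
    ∃ P : Finset ℕ, (∀ p ∈ P, p.Prime ∧ M < p) ∧ ε ≤ ∑ p ∈ P, (p : ℝ)⁻¹ ∧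
      ∑ p ∈ P, (p : ℝ)⁻¹ ≤ 2 * ε := by
  obtain ⟨M₁, hM₁⟩ := exists_nat_gt ε⁻¹
  have hM₁0 : (0 : ℝ) < M₁ := (inv_pos.2 hε).trans hM₁
  set N := max M M₁
  -- the partial sums of `∑ 1/p` over primes `p > N` increase in steps of size less than `ε`
  set f : ℕ → ℝ := Set.indicator {p | p.Prime ∧ N < p} (fun n : ℕ => (n : ℝ)⁻¹)
  have hf0 : ∀ n, 0 ≤ f n := fun n => Set.indicator_nonneg (fun _ _ => by positivity) n
  have hfε : ∀ n, f n ≤ ε := fun n => by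
    simp only [f, Set.indicator_apply]
    split_ifs with h
    · have : (M₁ : ℝ) < n := by exact_mod_cast (le_max_right M M₁).trans_lt h.2
      exact inv_le_of_inv_le₀ hε (hM₁.trans this).le
    · exact hε.le
  have hns : ¬ Summable f := by
    intro hs
    apply not_summable_one_div_on_primes
    rw [← summable_nat_add_iff (N + 1)] at hs ⊢
    convert hs using 2 with n
    simp only [f, Set.indicator_apply, Set.mem_ofPred_eq, one_div]
    have : N < n + (N + 1) := by omega
    simp [this]
  have htend := (not_summable_iff_tendsto_nat_atTop_of_nonneg hf0).1 hns
  have hex : ∃ n, ε ≤ ∑ i ∈ Finset.range n, f i := (htend.eventually_ge_atTop ε).exists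
  classical
  set m := Nat.find hex
  have hm := Nat.find_spec hex
  have hm0 : m ≠ 0 := by
    intro h
    have h' : ε ≤ ∑ i ∈ Finset.range m, f i := hm
    rw [h] at h'
    simp at h'
    linarith
  have hm1 : ∑ i ∈ Finset.range (m - 1), f i < ε :=
    not_le.1 (Nat.find_min hex (show m - 1 < m by omega))
  have hsum : ∑ p ∈ (Finset.range m).filter (fun p => p.Prime ∧ N < p), (p : ℝ)⁻¹ =
      ∑ i ∈ Finset.range m, f i := by
    rw [Finset.sum_filter]
    refine Finset.sum_congr rfl fun i _ => ?_
    simp only [f, Set.indicator_apply, Set.mem_ofPred_eq]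
  refine ⟨(Finset.range m).filter (fun p => p.Prime ∧ N < p), fun p hp => ?_, ?_, ?_⟩
  · have := (Finset.mem_filter.1 hp).2
    exact ⟨this.1, (le_max_left _ _).trans_lt this.2⟩
  · rw [hsum]; exact hm
  · rw [hsum, show m = (m - 1) + 1 by omega, Finset.sum_range_succ]
    linarith [hfε (m - 1)]

/-! ### Perturbation of the Fourier transform -/

/-- If `g` is a Fourier series with mean value `1`, the perturbation `(χ g)^ - χ^` is controlled by
any bound for the remaining terms of the convolution. -/
theorem norm_realFourier_mul_sub_le {χ g : ℝ → ℝ} (hχ : Integrable χ) {c : ℤ → ℂ}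
    (hc : Summable fun k => ‖c k‖)
    (hg : ∀ x : ℝ, (g x : ℂ) = ∑' k : ℤ, c k * Complex.exp (2 * Real.pi * Complex.I * k * x))
    (hc0 : c 0 = 1) {ξ A W : ℝ} (hA : 0 ≤ A)
    (hs : Summable fun k : ℤ => ((1 + |ξ - k|) ^ 2)⁻¹)
    (hW : ∑' k : ℤ, ((1 + |ξ - k|) ^ 2)⁻¹ ≤ W)
    (hb : ∀ k : ℤ, k ≠ 0 → ‖c k‖ * ‖realFourier χ (ξ - k)‖ ≤ A * ((1 + |ξ - k|) ^ 2)⁻¹) :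
    ‖realFourier (fun x => χ x * g x) ξ - realFourier χ ξ‖ ≤ A * W := by
  have h := hasSum_realFourier_mul hχ hc hg ξ
  have h1 := h.tsum_eq
  rw [h.summable.tsum_eq_add_tsum_ite 0, hc0] at h1
  have h2 : realFourier (fun x => χ x * g x) ξ - realFourier χ ξ =
      ∑' k : ℤ, if k = 0 then 0 else c k * realFourier χ (ξ - k) := by
    rw [← h1]; simp
  rw [h2]
  refine (tsum_of_norm_bounded (hs.mul_left A).hasSum fun k => ?_).trans ?_
  · split_ifs with hk
    · rw [norm_zero]; positivity
    · rw [norm_mul]; exact hb k hk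
  · rw [tsum_mul_left]; gcongr

/-- One step of the construction: multiplying by a kernel built on primes larger than `M` changes
the Fourier transform by at most `ε √α(1/|ξ|) ω(|ξ|)` and localises near fractions with these
denominators. -/
theorem exists_amplitude_step {α : ℝ → ℝ} (hα : IsDimensionFunction α) {δ : ℝ} (hδ : 0 < δ)
    (hratio : ∀ x₁ x₂ : ℝ, 0 < x₁ → x₁ ≤ x₂ → x₂ < δ → x₁ * α x₂ ≤ x₂ * α x₁)
    {B : ℕ} (hB : 0 < B) (hψ : ∀ᶠ q : ℕ in atTop, ((q : ℝ) ^ B)⁻¹ ≤ approxRadius α q)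
    {φ : ℝ → ℝ} (hf : ContDiff ℝ (⊤ : ℕ∞) φ) (hc : HasCompactSupport φ) (hφ0 : ∀ x, 0 ≤ φ x)
    (hφs : ∀ x, φ x ≠ 0 → |x| ≤ 1) (hφ1 : realFourier φ 0 = 1)
    {ω : ℝ → ℝ} (hω_pos : ∀ ξ : ℝ, 0 ≤ ξ → 0 < ω ξ)
    (hω_mono : MonotoneOn ω (Set.Ici 0)) (hω_lim : Tendsto ω atTop atTop)
    {χ : ℝ → ℝ} (hχ : IsAmplitude χ) {ε : ℝ} (hε : 0 < ε) (M : ℕ) :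
    ∃ (P : Finset ℕ) (χ' : ℝ → ℝ),
      (∀ p ∈ P, p.Prime ∧ M < p ∧ 0 < approxRadius α p ∧ approxRadius α p ≤ ε ∧
        α (2 * approxRadius α p) ≤ 4 * ((p : ℝ) ^ 2)⁻¹) ∧
      ∑ p ∈ P, (p : ℝ)⁻¹ ≤ 2 * ε ∧ IsAmplitude χ' ∧
      (∀ x, χ' x ≠ 0 → χ x ≠ 0 ∧ ∃ p ∈ P, ∃ a : ℤ, |x - (a : ℝ) / p| ≤ approxRadius α p) ∧
      (∀ ξ, ξ ≠ 0 →
        ‖realFourier χ' ξ - realFourier χ ξ‖ ≤ ε * (decayRate α ξ * ω |ξ|)) ∧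
      ‖realFourier χ' 0 - realFourier χ 0‖ ≤ ε := by
  obtain ⟨K, hK, M₀, hcoef⟩ := exists_norm_kernelCoeff_le hα hδ hratio hB hψ hf hc
  obtain ⟨T, hT1, hT⟩ := exists_decayRate_le_mul hα hδ hratio
  obtain ⟨W, hW, hsumW⟩ := exists_tsum_inv_sq_le
  obtain ⟨D, hD, hdec⟩ := hχ.decay
  obtain ⟨M₁, hM₁⟩ := eventually_atTop.1 ((eventually_approxRadius_bounds hα hδ hratio).and
    (eventually_approxRadius_le hα hε))
  -- beyond the frequency `R` the growth of `ω` absorbs the constants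
  obtain ⟨R, hR1, hR⟩ : ∃ R : ℝ, 1 ≤ R ∧ ε⁻¹ * K * D * W / ε ≤ ω R :=
    ((eventually_ge_atTop 1).and (hω_lim.eventually_ge_atTop _)).exists
  -- below `R` the smallness comes from the size of the primes
  set κ := min 1 (decayRate α R * ω 0)
  have hκ : 0 < κ := lt_min one_pos
    (mul_pos (decayRate_pos hα (by positivity)) (hω_pos 0 le_rfl))
  obtain ⟨M₂, hM₂⟩ := exists_nat_ge (ε⁻¹ * K * decayRate α 1 * D * (1 + R) * W / (ε * κ))
  obtain ⟨M₃, hM₃⟩ := exists_nat_ge T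
  set N := M + M₀ + M₁ + M₂ + M₃
  have hNT : T ≤ N := hM₃.trans (by exact_mod_cast (by omega : M₃ ≤ N))
  have hNM₂ : (M₂ : ℝ) ≤ N := by exact_mod_cast (by omega : M₂ ≤ N)
  have hN0 : (0 : ℝ) < N := by linarith
  obtain ⟨P, hP, hS1, hS2⟩ := exists_primes_sum_inv_mem hε N
  have hS0 : 0 < ∑ p ∈ P, (p : ℝ)⁻¹ := hε.trans_le hS1
  have hPψ : ∀ p ∈ P, 0 < approxRadius α p := fun p hp =>
    (hM₁ p (by have := (hP p hp).2; omega)).1.1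
  have hP0 : ∀ p ∈ P, 0 < p := fun p hp => (hP p hp).1.pos
  set c := kernelCoeff φ (approxRadius α) P
  set g := primeKernel φ (approxRadius α) P
  have hcs : Summable fun k : ℤ => ‖c k‖ * (1 + |(k : ℝ)|) ^ 3 :=
    summable_kernelCoeff_mul hf hc hPψ
  have hcs' : Summable fun k => ‖c k‖ := hcs.of_nonneg_of_le (fun k => norm_nonneg _)
    fun k => le_mul_of_one_le_right (norm_nonneg _) (one_le_pow₀ (by
      linarith [abs_nonneg (k : ℝ)]))
  have hgc : ∀ x : ℝ, (g x : ℂ) =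
      ∑' k : ℤ, c k * Complex.exp (2 * Real.pi * Complex.I * k * x) :=
    primeKernel_eq_tsum hf hc hP0 hPψ
  have hg0 : ∀ x, 0 ≤ g x := fun x => mul_nonneg (inv_nonneg.2 hS0.le)
    (Finset.sum_nonneg fun p hp => mul_nonneg (by positivity) (comb_nonneg hφ0 p (hPψ p hp) x))
  have hc0 : c 0 = 1 := kernelCoeff_zero hφ1 hS0
  have hcsmall : ∀ k : ℤ, k ≠ 0 → |(k : ℝ)| ≤ N → c k = 0 := fun k hk hkN =>
    kernelCoeff_eq_zero (fun p hp => (hP p hp).2) hk hkN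
  have hcb : ∀ k : ℤ, k ≠ 0 → ‖c k‖ ≤ ε⁻¹ * K * decayRate α k := fun k hk => by
    refine (hcoef P (fun p hp => ⟨(hP p hp).1, by have := (hP p hp).2; omega⟩) k hk).trans ?_
    rw [mul_assoc]
    exact mul_le_mul_of_nonneg_right (inv_anti₀ hε hS1)
      (mul_nonneg hK.le (decayRate_nonneg _ _))
  -- the estimate that is good at high frequencies
  have hhigh : ∀ ξ, ξ ≠ 0 → ‖realFourier (fun x => χ x * g x) ξ - realFourier χ ξ‖ ≤
      ε⁻¹ * K * decayRate α ξ * D * W := fun ξ hξ => by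
    have hβ := decayRate_nonneg α ξ
    refine norm_realFourier_mul_sub_le hχ.integrable hcs' hgc hc0 (by positivity) (hsumW ξ).1
      (hsumW ξ).2 fun k hk => ?_
    rcases le_or_gt |(k : ℝ)| N with h | h
    · rw [hcsmall k hk h, norm_zero, zero_mul]; positivity
    · calc ‖c k‖ * ‖realFourier χ (ξ - k)‖
          ≤ (ε⁻¹ * K * (decayRate α ξ * (1 + |ξ - k|))) * (D / (1 + |ξ - k|) ^ 3) := by
            refine mul_le_mul ((hcb k hk).trans ?_) (hdec _) (norm_nonneg _) (by positivity)
            exact mul_le_mul_of_nonneg_left (hT k ξ (hNT.trans h.le) hξ) (by positivity)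
        _ = _ := by field_simp
  -- the estimate that is good at low frequencies
  have hlow : ∀ ξ, |ξ| ≤ R → ‖realFourier (fun x => χ x * g x) ξ - realFourier χ ξ‖ ≤
      ε * κ := fun ξ hξ => by
    have hβ := decayRate_nonneg α 1
    have h1 : ‖realFourier (fun x => χ x * g x) ξ - realFourier χ ξ‖ ≤
        ε⁻¹ * K * decayRate α 1 * D * ((1 + R) / N) * W := by
      refine norm_realFourier_mul_sub_le hχ.integrable hcs' hgc hc0 (by positivity) (hsumW ξ).1
        (hsumW ξ).2 fun k hk => ?_
      rcases le_or_gt |(k : ℝ)| N with h | h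
      · rw [hcsmall k hk h, norm_zero, zero_mul]; positivity
      · have h2 : decayRate α k ≤ decayRate α 1 := decayRate_anti hα one_ne_zero
          (by rw [abs_one]; linarith)
        have h3 : (1 + |ξ - k|)⁻¹ ≤ (1 + R) / N := by
          rw [inv_eq_one_div, div_le_div_iff₀ (by positivity) hN0, one_mul]
          have := one_add_abs_le_mul k ξ
          rw [abs_sub_comm] at this
          nlinarith [abs_nonneg (ξ - k)]
        calc ‖c k‖ * ‖realFourier χ (ξ - k)‖
            ≤ (ε⁻¹ * K * decayRate α 1) * (D / (1 + |ξ - k|) ^ 3) := by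
              refine mul_le_mul ((hcb k hk).trans ?_) (hdec _) (norm_nonneg _) (by positivity)
              exact mul_le_mul_of_nonneg_left h2 (by positivity)
          _ = ε⁻¹ * K * decayRate α 1 * D * (1 + |ξ - k|)⁻¹ * ((1 + |ξ - k|) ^ 2)⁻¹ := by
              field_simp
          _ ≤ _ := by gcongr
    refine h1.trans ?_
    have h4 := hM₂.trans hNM₂
    rw [div_le_iff₀ (by positivity)] at h4
    rw [mul_div_assoc', div_mul_eq_mul_div, div_le_iff₀ hN0]
    linarith
  refine ⟨P, fun x => χ x * g x, fun p hp => ?_, hS2, ?_, fun x hx => ?_, fun ξ hξ => ?_, ?_⟩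
  · have hpN := (hP p hp).2
    have h := hM₁ p (by omega)
    exact ⟨(hP p hp).1, by omega, h.1.1, h.2, h.1.2.2⟩
  · exact hχ.mul (continuous_primeKernel hf hc hP0 hPψ) hg0 hcs hgc
  · refine ⟨left_ne_zero_of_mul hx, ?_⟩
    have h1 : ∑ p ∈ P, (p : ℝ)⁻¹ * comb φ p (approxRadius α p) x ≠ 0 :=
      right_ne_zero_of_mul (right_ne_zero_of_mul hx)
    obtain ⟨p, hp, h2⟩ := Finset.exists_ne_zero_of_sum_ne_zero h1
    exact ⟨p, hp, exists_abs_sub_le_of_comb_ne_zero hφs (hP0 p hp) (hPψ p hp)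
      (right_ne_zero_of_mul h2)⟩
  · rcases le_total |ξ| R with h | h
    · refine (hlow ξ h).trans (mul_le_mul_of_nonneg_left ((min_le_right _ _).trans ?_) hε.le)
      refine mul_le_mul (decayRate_anti hα hξ (h.trans (le_abs_self R)))
        (hω_mono (Set.mem_Ici.2 le_rfl) (Set.mem_Ici.2 (abs_nonneg ξ)) (abs_nonneg ξ))
        (hω_pos 0 le_rfl).le (decayRate_nonneg _ _)
    · refine (hhigh ξ hξ).trans ?_
      have h1 : ω R ≤ ω |ξ| :=
        hω_mono (Set.mem_Ici.2 (by linarith)) (Set.mem_Ici.2 (abs_nonneg ξ)) h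
      rw [div_le_iff₀ hε] at hR
      have h2 : ε⁻¹ * K * D * W ≤ ω |ξ| * ε := hR.trans (by gcongr)
      calc _ = decayRate α ξ * (ε⁻¹ * K * D * W) := by ring
        _ ≤ decayRate α ξ * (ω |ξ| * ε) :=
          mul_le_mul_of_nonneg_left h2 (decayRate_nonneg _ _)
        _ = _ := by ring
  · refine (hlow 0 (by rw [abs_zero]; linarith)).trans ?_
    exact (mul_le_mul_of_nonneg_left (min_le_left _ _) hε.le).trans_eq (mul_one ε)

/-- Smooth nonnegative bumps of integral `1` in any prescribed interval. -/
theorem exists_smooth_bump (x₀ : ℝ) {r : ℝ} (hr : 0 < r) :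
    ∃ φ : ℝ → ℝ, ContDiff ℝ (⊤ : ℕ∞) φ ∧ HasCompactSupport φ ∧ (∀ x, 0 ≤ φ x) ∧
      (∀ x, φ x ≠ 0 → |x - x₀| ≤ r) ∧ realFourier φ 0 = 1 := by
  let b : ContDiffBump x₀ := ⟨r / 2, r, by positivity, by linarith⟩
  refine ⟨b.normed volume, b.contDiff_normed, b.hasCompactSupport_normed,
    fun x => b.nonneg_normed x, fun x hx => ?_, ?_⟩
  · have h : x ∈ Function.support (b.normed volume) := hx
    rw [b.support_normed_eq] at h
    exact (Metric.mem_ball.1 h).le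
  · rw [realFourier_eq]
    simp only [Complex.ofReal_zero, mul_zero, Complex.exp_zero, one_mul]
    rw [integral_complex_ofReal, b.integral_normed, Complex.ofReal_one]

/-- A smooth bump decays at least like `1 / |ξ|`, which the growth condition makes faster than
`√α(1/|ξ|)`. -/
theorem exists_initial_amplitude {α : ℝ → ℝ} (hα : IsDimensionFunction α) {δ : ℝ} (hδ : 0 < δ)
    (hratio : ∀ x₁ x₂ : ℝ, 0 < x₁ → x₁ ≤ x₂ → x₂ < δ → x₁ * α x₂ ≤ x₂ * α x₁)
    {ω : ℝ → ℝ} (hω_pos : ∀ ξ : ℝ, 0 ≤ ξ → 0 < ω ξ) (hω_mono : MonotoneOn ω (Set.Ici 0)) :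
    ∃ χ : ℝ → ℝ, IsAmplitude χ ∧ realFourier χ 0 = 1 ∧ ∃ C : ℝ, 0 < C ∧
      ∀ ξ, ξ ≠ 0 → ‖realFourier χ ξ‖ ≤ C * (decayRate α ξ * ω |ξ|) := by
  obtain ⟨χ, hf, hc, h0, hs, h1⟩ := exists_smooth_bump (1 / 2) (show (0 : ℝ) < 1 / 2 by norm_num)
  obtain ⟨T, hT1, hT⟩ := exists_decayRate_le_mul hα hδ hratio
  obtain ⟨D, hD, hdec⟩ := exists_norm_realFourier_le hf hc 1
  have hβ := decayRate_pos hα (show T ≠ 0 by positivity)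
  have hω0 := hω_pos 0 le_rfl
  refine ⟨χ, ⟨hf.continuous, h0, fun x hx => ?_, exists_norm_realFourier_le hf hc 3⟩, h1,
    D * (1 + T) / (decayRate α T * ω 0), by positivity, fun ξ hξ => ?_⟩
  · have := abs_le.1 (hs x hx)
    constructor <;> linarith
  · refine (hdec ξ).trans ?_
    rw [pow_one, div_mul_eq_mul_div, div_le_div_iff₀ (by positivity) (by positivity)]
    have h2 := hT T ξ (le_abs_self T) hξ
    have h3 : ω 0 ≤ ω |ξ| :=
      hω_mono (Set.mem_Ici.2 le_rfl) (Set.mem_Ici.2 (abs_nonneg ξ)) (abs_nonneg ξ)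
    have h4 : 1 + |ξ - T| ≤ (1 + |ξ|) * (1 + T) := by
      have := one_add_abs_le_mul (ξ - T) (-T)
      rwa [sub_neg_eq_add, sub_add_cancel, abs_neg, abs_of_pos (show 0 < T by linarith)] at this
    have h5 := decayRate_nonneg α ξ
    calc D * (decayRate α T * ω 0)
        ≤ D * ((decayRate α ξ * ((1 + |ξ|) * (1 + T))) * ω |ξ|) := by
          gcongr
          exact h2.trans (by gcongr)
      _ = _ := by ring

/-! ### The limit measure -/

/-- The probability measure with density proportional to an amplitude. -/
theorem IsAmplitude.exists_probabilityMeasure {χ : ℝ → ℝ} (h : IsAmplitude χ)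
    (hm : 1 / 2 ≤ ‖realFourier χ 0‖) :
    ∃ μ : ProbabilityMeasure ℝ, (∀ A : Set ℝ, (∀ x, χ x ≠ 0 → x ∈ A) → (μ : Measure ℝ) Aᶜ = 0) ∧
      ∀ ξ, ‖measureFourier μ ξ‖ ≤ 2 * ‖realFourier χ ξ‖ := by
  set I := ∫ x, χ x
  have hI0 : 0 ≤ I := integral_nonneg h.nonneg
  have h0 : ‖realFourier χ 0‖ = I := by
    rw [realFourier_eq]
    simp only [Complex.ofReal_zero, mul_zero, Complex.exp_zero, one_mul]
    rw [integral_complex_ofReal, Complex.norm_real, Real.norm_of_nonneg hI0]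
  rw [h0] at hm
  have hI : 0 < I := by linarith
  set f : ℝ → ℝ≥0∞ := fun x => ENNReal.ofReal (χ x / I)
  have hfm : Measurable f := (h.continuous.measurable.div_const I).ennreal_ofReal
  have hprob : IsProbabilityMeasure (volume.withDensity f) := by
    constructor
    rw [withDensity_apply _ MeasurableSet.univ, Measure.restrict_univ,
      ← ofReal_integral_eq_lintegral_ofReal (h.integrable.div_const I)
        (Eventually.of_forall fun x => div_nonneg (h.nonneg x) hI0), integral_div,
      div_self hI.ne', ENNReal.ofReal_one]
  refine ⟨⟨volume.withDensity f, hprob⟩, fun A hA => ?_, fun ξ => ?_⟩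
  · change (volume.withDensity f) Aᶜ = 0
    rw [withDensity_apply_eq_zero hfm]
    convert measure_empty (μ := (volume : Measure ℝ))
    ext x
    simp only [Set.mem_inter_iff, Set.mem_ofPred_eq, Set.mem_compl_iff, Set.mem_empty_iff_false,
      iff_false, not_and, not_not]
    intro hx
    exact hA x fun h0 => hx (by simp [f, h0])
  · have h1 : measureFourier (volume.withDensity f) ξ = (I : ℂ)⁻¹ * realFourier χ ξ := by
      rw [measureFourier, integral_withDensity_eq_integral_toReal_smul hfm
        (Eventually.of_forall fun x => ENNReal.ofReal_lt_top), realFourier_eq,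
        ← integral_const_mul]
      congr 1; ext x
      simp only [f]
      rw [ENNReal.toReal_ofReal (div_nonneg (h.nonneg x) hI0), Complex.real_smul]
      push_cast; ring
    change ‖measureFourier (volume.withDensity f) ξ‖ ≤ _
    rw [h1, norm_mul, norm_inv, Complex.norm_real, Real.norm_of_nonneg hI0]
    gcongr
    exact inv_le_of_inv_le₀ two_pos (by linarith)

/-- A weak limit of normalised amplitudes is carried by the intersection of closed sets that carry
the late amplitudes, and inherits uniform bounds for the Fourier transforms. -/
theorem exists_limit_measure {χ : ℕ → ℝ → ℝ} (hχ : ∀ j, IsAmplitude (χ j))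
    (hm : ∀ j, 1 / 2 ≤ ‖realFourier (χ j) 0‖) {K : ℕ → Set ℝ} (hK : ∀ i, IsClosed (K i))
    (hχK : ∀ i j, i < j → ∀ x, χ j x ≠ 0 → x ∈ K i) {b : ℝ → ℝ}
    (hb : ∀ j ξ, ξ ≠ 0 → ‖realFourier (χ j) ξ‖ ≤ b ξ) :
    ∃ μ : Measure ℝ, IsProbabilityMeasure μ ∧ μ (Set.Icc 0 1 ∩ ⋂ i, K i)ᶜ = 0 ∧
      ∀ ξ, ξ ≠ 0 → ‖measureFourier μ ξ‖ ≤ 2 * b ξ := by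
  choose ν hν1 hν2 using fun j => (hχ j).exists_probabilityMeasure (hm j)
  have hcomp := isCompact_setOfPred_probabilityMeasure_mass_eq_compl_isCompact_le (E := ℝ)
    (u := fun _ => 0) (K := fun _ => Set.Icc 0 1) tendsto_const_nhds (fun _ => isCompact_Icc)
    (Or.inl inferInstance)
  have hmem : ∀ j, ν j ∈ {μ : ProbabilityMeasure ℝ | ∀ n : ℕ, μ (Set.Icc (0 : ℝ) 1)ᶜ ≤ 0} := by
    intro j n
    have := hν1 j _ (hχ j).mem_Icc
    rw [← ENNReal.coe_le_coe, ProbabilityMeasure.ennreal_coeFn_eq_coeFn_toMeasure, this]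
    simp
  obtain ⟨μ, hμ, hlim⟩ := hcomp.ultrafilter_le_nhds ((hyperfilter ℕ).map ν) (by
    rw [le_principal_iff]
    exact (Eventually.of_forall hmem : ∀ᶠ j in (hyperfilter ℕ : Filter ℕ), ν j ∈ _))
  have hlim' : Tendsto ν (hyperfilter ℕ) (𝓝 μ) := hlim
  refine ⟨μ, inferInstance, ?_, fun ξ hξ => ?_⟩
  · rw [Set.compl_inter, Set.compl_iInter]
    refine measure_union_null ?_ (measure_iUnion_null fun i => ?_)
    · have := hμ 0
      rw [← ENNReal.coe_le_coe, ProbabilityMeasure.ennreal_coeFn_eq_coeFn_toMeasure] at this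
      exact le_antisymm (by simpa using this) zero_le
    · have h1 := ProbabilityMeasure.le_liminf_measure_open_of_tendsto hlim' (hK i).isOpen_compl
      have h2 : (fun j => (ν j : Measure ℝ) (K i)ᶜ) =ᶠ[hyperfilter ℕ] fun _ => 0 := by
        have h3 : ∀ᶠ j in (hyperfilter ℕ : Filter ℕ), i < j :=
          Nat.hyperfilter_le_atTop (eventually_gt_atTop i)
        filter_upwards [h3] with j hj
        exact hν1 j _ (hχK i j hj)
      rw [liminf_congr h2, liminf_const] at h1
      exact le_antisymm h1 zero_le
  · have hnorm : ∀ x : ℝ, ‖Complex.exp (-2 * (Real.pi : ℂ) * Complex.I * (x : ℂ) * (ξ : ℂ))‖ ≤ 1 :=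
      fun x => by
        have := norm_exp_two_pi_mul (-ξ) x
        rw [show (-2 * (Real.pi : ℂ) * Complex.I * (x : ℂ) * (ξ : ℂ)) =
          2 * Real.pi * Complex.I * (-ξ : ℝ) * x by push_cast; ring, this]
    have h1 := (ProbabilityMeasure.tendsto_iff_forall_integral_rclike_tendsto ℂ).1 hlim'
      (BoundedContinuousFunction.ofNormedAddCommGroup
        (fun x : ℝ => Complex.exp (-2 * (Real.pi : ℂ) * Complex.I * (x : ℂ) * (ξ : ℂ)))
        (by fun_prop) 1 hnorm)
    have h2 : Tendsto (fun j => measureFourier (ν j) ξ) (hyperfilter ℕ)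
        (𝓝 (measureFourier μ ξ)) := h1
    refine le_of_tendsto h2.norm (Eventually.of_forall fun j => ?_)
    exact (hν2 j ξ).trans (mul_le_mul_of_nonneg_left (hb j ξ hξ) zero_le_two)

/-! ### Hausdorff measure of neighbourhoods of fractions -/

/-- The fractions `a / p`, `p ∈ P`, in `[-1, 2]`, as pairs `⟨p, a⟩`. -/
noncomputable def fractionIndex (P : Finset ℕ) : Finset (Σ _ : ℕ, ℤ) :=
  P.sigma fun p => Finset.Icc (-(p : ℤ)) (2 * p)

/-- The closed `ψ(p)`-neighbourhood of the fractions `a / p`, `p ∈ P`, in `[-1, 2]`. -/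
noncomputable def fractionNhd (ψ : ℕ → ℝ) (P : Finset ℕ) : Set ℝ :=
  ⋃ i ∈ fractionIndex P, Metric.closedBall ((i.2 : ℝ) / i.1) (ψ i.1)

theorem isClosed_fractionNhd (ψ : ℕ → ℝ) (P : Finset ℕ) : IsClosed (fractionNhd ψ P) :=
  (fractionIndex P).finite_toSet.isClosed_biUnion fun _ _ => Metric.isClosed_closedBall

theorem mem_fractionNhd {ψ : ℕ → ℝ} {P : Finset ℕ} {x : ℝ} (hx : x ∈ Set.Icc (0 : ℝ) 1) {p : ℕ}
    (hp : p ∈ P) (hp0 : 0 < p) (hψ : ψ p ≤ 1) {a : ℤ} (ha : |x - (a : ℝ) / p| ≤ ψ p) :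
    x ∈ fractionNhd ψ P := by
  have hp0' : (0 : ℝ) < p := by exact_mod_cast hp0
  have h1 := abs_le.1 (ha.trans hψ)
  have h2 : -1 ≤ (a : ℝ) / p := by linarith [hx.1, h1.2]
  have h3 : (a : ℝ) / p ≤ 2 := by linarith [hx.2, h1.1]
  rw [le_div_iff₀ hp0'] at h2
  rw [div_le_iff₀ hp0'] at h3
  have h4 : -(p : ℤ) ≤ a := by exact_mod_cast (by linarith : -(p : ℝ) ≤ a)
  have h5 : a ≤ 2 * p := by exact_mod_cast h3
  refine Set.mem_iUnion₂.2 ⟨⟨p, a⟩, ?_, ?_⟩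
  · simp [fractionIndex, hp, h4, h5]
  · simpa [Real.dist_eq] using ha

theorem exists_of_mem_fractionNhd {ψ : ℕ → ℝ} {P : Finset ℕ} {x : ℝ}
    (hx : x ∈ fractionNhd ψ P) : ∃ p ∈ P, ∃ a : ℤ, |x - (a : ℝ) / p| ≤ ψ p := by
  obtain ⟨⟨p, a⟩, hi, hx⟩ := Set.mem_iUnion₂.1 hx
  exact ⟨p, (Finset.mem_sigma.1 hi).1, a, by simpa [Real.dist_eq] using hx⟩

theorem dimGauge_closedBall (α : ℝ → ℝ) (x : ℝ) {r : ℝ} (hr : 0 < r) :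
    dimGauge α (Metric.ediam (Metric.closedBall x r)) = ENNReal.ofReal (α (2 * r)) := by
  rw [Real.closedBall_eq_Icc, Real.ediam_Icc, dimGauge, if_neg, if_neg ENNReal.ofReal_ne_top,
    ENNReal.toReal_ofReal (by linarith)]
  · congr 2; ring
  · rw [ENNReal.ofReal_eq_zero]; linarith

/-- The covering of `fractionNhd` by its defining balls costs at most a multiple of `∑ 1/p`. -/
theorem sum_dimGauge_le {α : ℝ → ℝ} (hα : IsDimensionFunction α) {ψ : ℕ → ℝ} {P : Finset ℕ}
    {ε : ℝ}
    (hP : ∀ p ∈ P, 0 < p ∧ 0 < ψ p ∧ α (2 * ψ p) ≤ 4 * ((p : ℝ) ^ 2)⁻¹)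
    (hS : ∑ p ∈ P, (p : ℝ)⁻¹ ≤ ε) :
    ∑ i ∈ fractionIndex P, dimGauge α (Metric.ediam
      (Metric.closedBall ((i.2 : ℝ) / (i.1 : ℝ)) (ψ i.1))) ≤ ENNReal.ofReal (16 * ε) := by
  have h1 : ∀ i ∈ fractionIndex P, dimGauge α (Metric.ediam
      (Metric.closedBall ((i.2 : ℝ) / (i.1 : ℝ)) (ψ i.1))) = ENNReal.ofReal (α (2 * ψ i.1)) :=
    fun i hi => dimGauge_closedBall α _ (hP _ (Finset.mem_sigma.1 hi).1).2.1
  have h2 : ∀ i ∈ fractionIndex P, 0 ≤ α (2 * ψ i.1) := fun i hi =>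
    (hα.pos _ (mul_pos two_pos (hP _ (Finset.mem_sigma.1 hi).1).2.1)).le
  rw [Finset.sum_congr rfl h1, ← ENNReal.ofReal_sum_of_nonneg h2]
  apply ENNReal.ofReal_le_ofReal
  rw [fractionIndex, Finset.sum_sigma]
  calc _ ≤ ∑ p ∈ P, 16 * (p : ℝ)⁻¹ := Finset.sum_le_sum fun p hp => by
        obtain ⟨hp0, -, hp2⟩ := hP p hp
        have hp0' : (1 : ℝ) ≤ p := by exact_mod_cast hp0
        have hcard : ((Finset.Icc (-(p : ℤ)) (2 * p)).card : ℝ) = 3 * p + 1 := by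
          rw [Int.card_Icc]
          have : (2 * (p : ℤ) + 1 - -(p : ℤ)).toNat = 3 * p + 1 := by omega
          rw [this]; push_cast; ring
        rw [Finset.sum_const (α (2 * ψ p)), nsmul_eq_mul, hcard]
        calc (3 * (p : ℝ) + 1) * α (2 * ψ p) ≤ (4 * p) * (4 * ((p : ℝ) ^ 2)⁻¹) := by
              refine mul_le_mul (by linarith) hp2 ?_ (by positivity)
              exact (hα.pos _ (mul_pos two_pos (hP p hp).2.1)).le
          _ = _ := by field_simp; ring
    _ ≤ _ := by rw [← Finset.mul_sum]; gcongr

theorem hausdorffMeasureOf_iInter_fractionNhd_eq_zero {α : ℝ → ℝ} (hα : IsDimensionFunction α)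
    {ψ : ℕ → ℝ} {P : ℕ → Finset ℕ} {ε : ℕ → ℝ} (hε : Tendsto ε atTop (𝓝 0))
    (hP : ∀ n, ∀ p ∈ P n, 0 < p ∧ 0 < ψ p ∧ α (2 * ψ p) ≤ 4 * ((p : ℝ) ^ 2)⁻¹)
    (hψ : ∀ n, ∀ p ∈ P n, ψ p ≤ ε n) (hS : ∀ n, ∑ p ∈ P n, (p : ℝ)⁻¹ ≤ 2 * ε n)
    {F : Set ℝ} (hF : ∀ n, F ⊆ fractionNhd ψ (P n)) : hausdorffMeasureOf α F = 0 := by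
  have hlim : ∀ c : ℝ, Tendsto (fun n => ENNReal.ofReal (c * ε n)) atTop (𝓝 0) := fun c => by
    simpa using ENNReal.tendsto_ofReal (hε.const_mul c)
  have h := Measure.mkMetric_le_liminf_sum (X := ℝ) (ι := fun n => fractionIndex (P n)) F
    (l := atTop) (fun n => ENNReal.ofReal (2 * ε n)) (hlim 2)
    (fun n i => Metric.closedBall ((i.1.2 : ℝ) / (i.1.1 : ℝ)) (ψ i.1.1))
    (Eventually.of_forall fun n i => by
      rw [Real.closedBall_eq_Icc, Real.ediam_Icc]
      apply ENNReal.ofReal_le_ofReal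
      linarith [hψ n i.1.1 (Finset.mem_sigma.1 i.2).1])
    (Eventually.of_forall fun n x hx => by
      obtain ⟨i, hi, hxi⟩ := Set.mem_iUnion₂.1 (hF n hx)
      exact Set.mem_iUnion.2 ⟨⟨i, hi⟩, hxi⟩)
    (dimGauge α)
  refine le_antisymm (h.trans ?_) zero_le
  refine (liminf_le_liminf (Eventually.of_forall fun n => ?_)).trans_eq (hlim 32).liminf_eq
  refine (Finset.sum_coe_sort (fractionIndex (P n)) fun i => dimGauge α (Metric.ediam
    (Metric.closedBall ((i.2 : ℝ) / (i.1 : ℝ)) (ψ i.1)))).trans_le ?_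
  refine (sum_dimGauge_le hα (hP n) (hS n)).trans_eq ?_
  congr 1; ring

/-! ### The construction -/

theorem theorem2 (α : ℝ → ℝ) (hα : IsDimensionFunction α)
    (ν : ℝ) (hν : 0 < ν)
    (hlim : Tendsto (fun x : ℝ => Real.log (α x) / Real.log x) (𝓝[>] 0) (𝓝 ν))
    (ρ : ℝ) (hρ : ρ < 1)
    (hgrowth : ∃ δ : ℝ, 0 < δ ∧ ∀ x₁ x₂ : ℝ, 0 < x₁ → x₁ < x₂ → x₂ < δ →
      (x₁ / x₂) ^ ρ ≤ α x₁ / α x₂)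
    (ω : ℝ → ℝ) (hω_pos : ∀ ξ : ℝ, 0 ≤ ξ → 0 < ω ξ)
    (hω_mono : MonotoneOn ω (Set.Ici 0)) (hω_lim : Tendsto ω atTop atTop) :
    ∃ F : Set ℝ, IsCompact F ∧ hausdorffMeasureOf α F = 0 ∧
      F ⊆ psiApproximable (fun q : ℕ => increasingInverse α (((q : ℝ) ^ 2)⁻¹)) ∧
      ∃ μ : Measure ℝ, IsProbabilityMeasure μ ∧ μ Fᶜ = 0 ∧
        ∃ C : ℝ, ∀ ξ : ℝ, ξ ≠ 0 →
          ‖measureFourier μ ξ‖ ≤ C * (Real.sqrt (α (1 / |ξ|)) * ω |ξ|) := by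
  obtain ⟨δ, hδ, hratio⟩ := gauge_ratio_le hα hρ hgrowth
  obtain ⟨B, hB, hψ⟩ := exists_eventually_inv_pow_le_approxRadius hα hν hlim hδ hratio
  obtain ⟨φ, hf, hc, hφ0, hφs, hφ1⟩ := exists_smooth_bump 0 one_pos
  simp only [sub_zero] at hφs
  obtain ⟨χ₀, hχ₀, hχ₀1, C, hC, hχ₀C⟩ := exists_initial_amplitude hα hδ hratio hω_pos hω_mono
  set ε : ℕ → ℝ := fun j => (1 / 2) ^ (j + 2)
  have hε : ∀ j, 0 < ε j := fun j => by positivity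
  have hε1 : ∀ j, ε j ≤ 1 := fun j => pow_le_one₀ (by norm_num) (by norm_num)
  have hεlim : Tendsto ε atTop (𝓝 0) :=
    (tendsto_pow_atTop_nhds_zero_of_lt_one (by norm_num) (by norm_num)).comp
      (tendsto_add_atTop_nat 2)
  choose P next hP hS hnext hsupp hdiff hdiff0 using
    fun (χ : {χ : ℝ → ℝ // IsAmplitude χ}) (j : ℕ) => exists_amplitude_step hα hδ hratio hB hψ
      hf hc hφ0 hφs hφ1 hω_pos hω_mono hω_lim χ.2 (hε j) j
  set χ : ℕ → {χ : ℝ → ℝ // IsAmplitude χ} := fun j =>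
    Nat.rec ⟨χ₀, hχ₀⟩ (fun j χ => ⟨next χ j, hnext χ j⟩) j
  have hχ_succ : ∀ j, (χ (j + 1)).1 = next (χ j) j := fun j => rfl
  set Q : ℕ → Finset ℕ := fun j => P (χ j) j
  set K : ℕ → Set ℝ := fun j => fractionNhd (approxRadius α) (Q j)
  have hcarry : ∀ i j, i < j → ∀ x, (χ j).1 x ≠ 0 → x ∈ K i := by
    intro i j hij
    induction j, hij using Nat.le_induction with
    | base =>
      intro x hx
      rw [hχ_succ] at hx
      obtain ⟨hx', p, hp, a, ha⟩ := hsupp (χ i) i x hx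
      have h := hP (χ i) i p hp
      exact mem_fractionNhd ((χ i).2.mem_Icc x hx') hp h.1.pos (h.2.2.2.1.trans (hε1 i)) ha
    | succ j _ ih =>
      intro x hx
      rw [hχ_succ] at hx
      exact ih x (hsupp (χ j) j x hx).1
  -- the total perturbation is at most `∑ ε j = 1 / 2`
  have hmass : ∀ j, 1 / 2 + (1 / 2) ^ (j + 1) ≤ ‖realFourier (χ j).1 0‖ := by
    intro j
    induction j with
    | zero =>
      change _ ≤ ‖realFourier χ₀ 0‖
      rw [hχ₀1, norm_one]; norm_num
    | succ j ih =>
      have h1 := hdiff0 (χ j) j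
      rw [hχ_succ]
      have h2 := norm_sub_norm_le (realFourier (χ j).1 0) (realFourier (next (χ j) j) 0)
      rw [norm_sub_rev] at h2
      have h3 : ((1 : ℝ) / 2) ^ (j + 1) = ε j + (1 / 2) ^ (j + 1 + 1) := by
        simp only [ε]; ring
      linarith
  have hdecay : ∀ j ξ, ξ ≠ 0 → ‖realFourier (χ j).1 ξ‖ ≤
      (C + 1 / 2 - (1 / 2) ^ (j + 1)) * (decayRate α ξ * ω |ξ|) := by
    intro j ξ hξ
    induction j with
    | zero =>
      refine (show ‖realFourier χ₀ ξ‖ ≤ _ from hχ₀C ξ hξ).trans_eq ?_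
      congr 1; norm_num
    | succ j ih =>
      have h1 := hdiff (χ j) j ξ hξ
      rw [hχ_succ]
      have h2 := norm_sub_norm_le (realFourier (next (χ j) j) ξ) (realFourier (χ j).1 ξ)
      have h3 : ((1 : ℝ) / 2) ^ (j + 1) = ε j + (1 / 2) ^ (j + 1 + 1) := by
        simp only [ε]; ring
      rw [h3] at ih
      linarith
  obtain ⟨μ, hμ, hμF, hμξ⟩ := exists_limit_measure (χ := fun j => (χ j).1) (fun j => (χ j).2)
    (fun j => le_trans (le_add_of_nonneg_right (by positivity)) (hmass j))
    (fun i => isClosed_fractionNhd (approxRadius α) (Q i)) hcarry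
    (b := fun ξ => (C + 1 / 2) * (decayRate α ξ * ω |ξ|)) fun j ξ hξ =>
      (hdecay j ξ hξ).trans (mul_le_mul_of_nonneg_right
        (by linarith [show (0 : ℝ) < (1 / 2) ^ (j + 1) by positivity])
        (mul_nonneg (decayRate_nonneg _ _) (hω_pos _ (abs_nonneg ξ)).le))
  refine ⟨Set.Icc 0 1 ∩ ⋂ i, K i, isCompact_Icc.inter_right
    (isClosed_iInter fun i => isClosed_fractionNhd _ _), ?_, fun x hx => ?_, μ, hμ, hμF,
    2 * (C + 1 / 2), fun ξ hξ => (hμξ ξ hξ).trans_eq (mul_assoc _ _ _).symm⟩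
  · refine hausdorffMeasureOf_iInter_fractionNhd_eq_zero hα (ψ := approxRadius α) (P := Q) hεlim
      (fun n p hp => ?_) (fun n p hp => ?_) (fun n => hS (χ n) n)
      fun n => Set.inter_subset_right.trans (Set.iInter_subset K n)
    · have h := hP (χ n) n p hp
      exact ⟨h.1.pos, h.2.2.1, h.2.2.2.2⟩
    · exact (hP (χ n) n p hp).2.2.2.1
  · -- the `j`-th neighbourhood supplies an approximation with denominator larger than `j`
    intro hfin
    obtain ⟨n, hn⟩ := (hfin.image Prod.snd).bddAbove
    obtain ⟨p, hp, a, ha⟩ := exists_of_mem_fractionNhd (Set.mem_iInter.1 hx.2 n)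
    have h := hP (χ n) n p hp
    exact absurd (hn ⟨(a, p), ⟨h.1.pos, ha⟩, rfl⟩) (not_le.2 h.2.1)
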